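/- Let $(M^m,g)$ be a connected smooth Riemannian manifold, $(N^n,h)$ a smooth Riemannian manifold (both without boundary), and $\varphi:M\to N$ a smooth isometric immersion, $\varphi^*h=g$. Let $B(X,Y)$ be its second fundamental form (the normal component of $\nabla^N_X d\varphi(Y)$), $\eta=\frac1m\,\mathrm{Trace}_g B$ its mean curvature vector field and, for a normal field $\xi$, let $A_\xi$ be the shape operator, where $-d\varphi(A_\xi X)$ is the tangential component of $\nabla^{N}_X\xi$. Let $\tau(\varphi)=\mathrm{Trace}_g\nabla d\varphi$ be the tension field and $$\tau_2(\varphi)=\mathrm{Trace}_g(\nabla^\varphi\nabla^\varphi-\nabla^\varphi_{\nabla^M})\tau(\varphi)-\mathrm{Trace}_g R^N(d\varphi,\tau(\varphi))d\varphi$$ the bitension field, where $\nabla^\varphi$ is the connection on vector fields along $\varphi$ induced by the Levi-Civita connection $\nabla^N$ and $R^N(X,Y)Z=[\nabla^N_X,\nabla^N_Y]Z-\nabla^N_{[X,Y]}Z$. Suppose that $\varphi$ is pseudo-umbilical, i.e. $A_\eta(X)=\langle\eta,\eta\rangle X$ for every tangent vector $X$, and proper biharmonic, i.e. $\tau_2(\varphi)=0$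 on $M$ and $\varphi$ is not minimal ($\eta$ does not vanish identically). Suppose further that $\varphi$ is $f$-biharmonic for a smooth function $f:M\to(0,\infty)$, i.e. $$\tau_{2,f}(\varphi)=f\,\tau_2(\varphi)+(\Delta f)\,\tau(\varphi)+2\nabla^\varphi_{\mathrm{grad} f}\tau(\varphi)=0\quad\text{on }M .$$ Then $f$ is constant on $M$. -/

import Mathlib

open scoped Manifold ContDiff

noncomputable section

namespace FBiharm

/-- The coordinate space `ℝᵏ`. -/
abbrev Coord (k : ℕ) : Type := EuclideanSpace ℝ (Fin k)

/-- A smooth Riemannian metric on a smooth `k`-dimensional manifold. -/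
abbrev RMetric (k : ℕ) (M : Type*) [TopologicalSpace M] [ChartedSpace (Coord k) M]
    [IsManifold (𝓡 k) ∞ M] : Type _ :=
  Bundle.ContMDiffRiemannianMetric (𝓡 k) ∞ (Coord k) (fun p : M => TangentSpace (𝓡 k) p)

/-! ### Riemannian geometry in coordinates

Below, `G x` and `H y` are metrics on open sets of `ℝᵐ` and `ℝⁿ` (bilinear forms depending on the
point) and `φ` is a map from the first open set to the second. -/

section Coordinates

variable {m n : ℕ}

/-- The coordinate vector `∂ᵢ`. -/
def coordVec (i : Fin m) : Coord m := EuclideanSpace.single i 1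

/-- The inverse matrix `g^{ij}` of the matrix `g_{ij} = G(∂ᵢ, ∂ⱼ)` of the metric at `x`. -/
def inverseMetric (G : Coord m → Coord m →L[ℝ] Coord m →L[ℝ] ℝ) (x : Coord m) :
    Matrix (Fin m) (Fin m) ℝ :=
  (Matrix.of fun i j => G x (coordVec i) (coordVec j))⁻¹

/-- The metric trace `∑ g^{ij} T(∂ᵢ, ∂ⱼ)` of a bilinear expression `T` at `x`. -/
def metricTrace {W : Type*} [AddCommGroup W] [Module ℝ W]
    (G : Coord m → Coord m →L[ℝ] Coord m →L[ℝ] ℝ) (x : Coord m)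
    (T : Coord m → Coord m → W) : W :=
  ∑ i, ∑ j, inverseMetric G x i j • T (coordVec i) (coordVec j)

/-- The Christoffel map of the Levi-Civita connection:
`Γ(v, w)^k = ∑ₗ g^{kl} · ½ (∂_v G(w, ∂ₗ) + ∂_w G(v, ∂ₗ) - ∂ₗ G(v, w))`. -/
def christoffel (G : Coord m → Coord m →L[ℝ] Coord m →L[ℝ] ℝ) (x v w : Coord m) : Coord m :=
  ∑ k, (∑ l, inverseMetric G x k l *
    ((1 / 2 : ℝ) * (fderiv ℝ G x v w (coordVec l) + fderiv ℝ G x w v (coordVec l)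
      - fderiv ℝ G x (coordVec l) v w))) • coordVec k

/-- The curvature operator `R(u, v)w = ∇ᵤ∇ᵥw - ∇ᵥ∇ᵤw - ∇_{[u,v]}w` at `y`, computed with the
constant (hence commuting) coordinate fields `u`, `v`, `w`, for which `∇ᵥw = Γ(v, w)`. -/
def curvature (H : Coord n → Coord n →L[ℝ] Coord n →L[ℝ] ℝ) (y u v w : Coord n) : Coord n :=
  (fderiv ℝ (fun z => christoffel H z v w) y u + christoffel H y u (christoffel H y v w))
    - (fderiv ℝ (fun z => christoffel H z u w) y v + christoffel H y v (christoffel H y u w))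

/-- The gradient `(grad f)^i = ∑ⱼ g^{ij} ∂ⱼf`. -/
def gradient (G : Coord m → Coord m →L[ℝ] Coord m →L[ℝ] ℝ) (f : Coord m → ℝ) (x : Coord m) :
    Coord m :=
  ∑ i, (∑ j, inverseMetric G x i j * fderiv ℝ f x (coordVec j)) • coordVec i

/-- The Laplace-Beltrami operator `Δf`, the trace of the Hessian
`(∇df)(v, w) = ∂_v(df(w)) - df(∇ᵥw)`. -/
def laplacian (G : Coord m → Coord m →L[ℝ] Coord m →L[ℝ] ℝ) (f : Coord m → ℝ) (x : Coord m) :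
    ℝ :=
  metricTrace G x fun v w =>
    fderiv ℝ (fun z => fderiv ℝ f z w) x v - fderiv ℝ f x (christoffel G x v w)

/-- The connection `∇^φ` on vector fields along `φ` induced by the Levi-Civita connection of `H`:
`∇^φ_v V = ∂_v V + Γ(dφ v, V)`. -/
def covAlong (H : Coord n → Coord n →L[ℝ] Coord n →L[ℝ] ℝ) (φ : Coord m → Coord n)
    (V : Coord m → Coord n) (x v : Coord m) : Coord n :=
  fderiv ℝ V x v + christoffel H (φ x) (fderiv ℝ φ x v) (V x)

/-- The tension field `τ(φ) = Trace_g ∇dφ`, where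
`(∇dφ)(v, w) = ∇^φ_v (dφ w) - dφ(∇^M_v w)`. -/
def tension (G : Coord m → Coord m →L[ℝ] Coord m →L[ℝ] ℝ)
    (H : Coord n → Coord n →L[ℝ] Coord n →L[ℝ] ℝ) (φ : Coord m → Coord n) (x : Coord m) :
    Coord n :=
  metricTrace G x fun v w =>
    covAlong H φ (fun z => fderiv ℝ φ z w) x v - fderiv ℝ φ x (christoffel G x v w)

/-- `Trace_g (∇^φ ∇^φ - ∇^φ_{∇^M}) V` for a vector field `V` along `φ`. -/
def roughLaplacian (G : Coord m → Coord m →L[ℝ] Coord m →L[ℝ] ℝ)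
    (H : Coord n → Coord n →L[ℝ] Coord n →L[ℝ] ℝ) (φ : Coord m → Coord n)
    (V : Coord m → Coord n) (x : Coord m) : Coord n :=
  metricTrace G x fun v w =>
    covAlong H φ (fun z => covAlong H φ V z w) x v - covAlong H φ V x (christoffel G x v w)

/-- The bitension field
`τ₂(φ) = Trace_g (∇^φ ∇^φ - ∇^φ_{∇^M}) τ(φ) - Trace_g R^N(dφ, τ(φ)) dφ`. -/
def bitension (G : Coord m → Coord m →L[ℝ] Coord m →L[ℝ] ℝ)
    (H : Coord n → Coord n →L[ℝ] Coord n →L[ℝ] ℝ) (φ : Coord m → Coord n) (x : Coord m) :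
    Coord n :=
  roughLaplacian G H φ (tension G H φ) x
    - metricTrace G x fun v w =>
        curvature H (φ x) (fderiv ℝ φ x v) (tension G H φ x) (fderiv ℝ φ x w)

/-- The `f`-bitension field `τ_{2,f}(φ) = f τ₂(φ) + (Δf) τ(φ) + 2 ∇^φ_{grad f} τ(φ)`. -/
def fBitension (G : Coord m → Coord m →L[ℝ] Coord m →L[ℝ] ℝ)
    (H : Coord n → Coord n →L[ℝ] Coord n →L[ℝ] ℝ) (φ : Coord m → Coord n) (f : Coord m → ℝ)
    (x : Coord m) : Coord n :=
  f x • bitension G H φ x + laplacian G f x • tension G H φ x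
    + (2 : ℝ) • covAlong H φ (tension G H φ) x (gradient G f x)

/-- For an isometric immersion `φ`, the tangent vector `Z` such that `dφ Z` is the tangential part
of the vector `W` at `φ x`, i.e. `Z^i = ∑ⱼ g^{ij} H(W, dφ ∂ⱼ)`. -/
def tangentPart (G : Coord m → Coord m →L[ℝ] Coord m →L[ℝ] ℝ)
    (H : Coord n → Coord n →L[ℝ] Coord n →L[ℝ] ℝ) (φ : Coord m → Coord n) (x : Coord m)
    (W : Coord n) : Coord m :=
  ∑ i, (∑ j, inverseMetric G x i j * H (φ x) W (fderiv ℝ φ x (coordVec j))) • coordVec i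

/-- The second fundamental form of an isometric immersion: `B(v, w)` is the normal part of
`∇^N_v (dφ w)`. -/
def secondFundForm (G : Coord m → Coord m →L[ℝ] Coord m →L[ℝ] ℝ)
    (H : Coord n → Coord n →L[ℝ] Coord n →L[ℝ] ℝ) (φ : Coord m → Coord n)
    (x v w : Coord m) : Coord n :=
  covAlong H φ (fun z => fderiv ℝ φ z w) x v
    - fderiv ℝ φ x (tangentPart G H φ x (covAlong H φ (fun z => fderiv ℝ φ z w) x v))

/-- The mean curvature vector field `η = (1/m) Trace_g B`. -/
def meanCurvature (G : Coord m → Coord m →L[ℝ] Coord m →L[ℝ] ℝ)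
    (H : Coord n → Coord n →L[ℝ] Coord n →L[ℝ] ℝ) (φ : Coord m → Coord n) (x : Coord m) :
    Coord n :=
  (1 / m : ℝ) • metricTrace G x fun v w => secondFundForm G H φ x v w

/-- The shape operator `A_ξ` with respect to the normal field `ξ`: by Weingarten's formula
`∇^N_v ξ = -dφ(A_ξ v) + ∇^⊥_v ξ`, so `A_ξ v` is minus the tangential part of `∇^N_v ξ`. -/
def shapeOperator (G : Coord m → Coord m →L[ℝ] Coord m →L[ℝ] ℝ)
    (H : Coord n → Coord n →L[ℝ] Coord n →L[ℝ] ℝ) (φ : Coord m → Coord n)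
    (ξ : Coord m → Coord n) (x v : Coord m) : Coord m :=
  -tangentPart G H φ x (covAlong H φ ξ x v)

end Coordinates

/-! ### The notions on manifolds -/

section Manifolds

variable {m n : ℕ}
  {M : Type*} [TopologicalSpace M] [ChartedSpace (Coord m) M] [IsManifold (𝓡 m) ∞ M]
  {N : Type*} [TopologicalSpace N] [ChartedSpace (Coord n) N] [IsManifold (𝓡 n) ∞ N]

/-- The coordinate expression of a Riemannian metric in a chart `c`, i.e. its pullback under
the parametrization `c.symm`. -/
def metricInChart (g : RMetric m M) (c : OpenPartialHomeomorph M (Coord m)) (x : Coord m) :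
    Coord m →L[ℝ] Coord m →L[ℝ] ℝ :=
  let T : Coord m →L[ℝ] Coord m := mfderiv (𝓡 m) (𝓡 m) c.symm x
  let B : Coord m →L[ℝ] Coord m →L[ℝ] ℝ := g.inner (c.symm x)
  B.bilinearComp T T

theorem metricInChart_apply (g : RMetric m M) (c : OpenPartialHomeomorph M (Coord m))
    (x v w : Coord m) :
    metricInChart g c x v w =
      g.inner (c.symm x) (mfderiv (𝓡 m) (𝓡 m) c.symm x v) (mfderiv (𝓡 m) (𝓡 m) c.symm x w) :=
  rfl

/-- The relation `P` between the chart of `M`, the coordinate expressions of `g`, `h`, `φ` and the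
point holds at all points of all pairs of smooth charts `c` of `M` and `d` of `N`. It is used only
for relations that do not depend on the choice of coordinates. -/
def InAllCharts (g : RMetric m M) (h : RMetric n N) (φ : M → N)
    (P : OpenPartialHomeomorph M (Coord m) →
      (Coord m → Coord m →L[ℝ] Coord m →L[ℝ] ℝ) → (Coord n → Coord n →L[ℝ] Coord n →L[ℝ] ℝ) →
      (Coord m → Coord n) → Coord m → Prop) : Prop :=
  ∀ c ∈ IsManifold.maximalAtlas (𝓡 m) ∞ M, ∀ d ∈ IsManifold.maximalAtlas (𝓡 n) ∞ N,
    ∀ x ∈ c.target, φ (c.symm x) ∈ d.source →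
      P c (metricInChart g c) (metricInChart h d) (fun z => d (φ (c.symm z))) x

/-- `φ : (M, g) → (N, h)` is a smooth isometric immersion, `φ^*h = g`. -/
structure IsIsometricImmersion (g : RMetric m M) (h : RMetric n N) (φ : M → N) : Prop where
  smooth : ContMDiff (𝓡 m) (𝓡 n) ∞ φ
  isometric : ∀ (p : M) (v w : TangentSpace (𝓡 m) p),
    h.inner (φ p) (mfderiv (𝓡 m) (𝓡 n) φ p v) (mfderiv (𝓡 m) (𝓡 n) φ p w) = g.inner p v w

/-- The submanifold is minimal: `η = 0`. -/
def IsMinimal (g : RMetric m M) (h : RMetric n N) (φ : M → N) : Prop :=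
  InAllCharts g h φ fun _ G H φ' x => meanCurvature G H φ' x = 0

/-- The submanifold is pseudo-umbilical: `A_η(X) = ⟨η, η⟩ X` for all tangent vectors `X`. -/
def IsPseudoUmbilical (g : RMetric m M) (h : RMetric n N) (φ : M → N) : Prop :=
  InAllCharts g h φ fun _ G H φ' x => ∀ v : Coord m,
    shapeOperator G H φ' (meanCurvature G H φ') x v
      = H (φ' x) (meanCurvature G H φ' x) (meanCurvature G H φ' x) • v

/-- `φ` is biharmonic: `τ₂(φ) = 0`. -/
def IsBiharmonic (g : RMetric m M) (h : RMetric n N) (φ : M → N) : Prop :=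
  InAllCharts g h φ fun _ G H φ' x => bitension G H φ' x = 0

/-- `φ` is `f`-biharmonic for the function `f`: `f` is smooth and positive and
`τ_{2,f}(φ) = 0`. -/
structure IsFBiharmonic (g : RMetric m M) (h : RMetric n N) (φ : M → N) (f : M → ℝ) :
    Prop where
  smooth : ContMDiff (𝓡 m) 𝓘(ℝ, ℝ) ∞ f
  pos : ∀ p, 0 < f p
  equation : InAllCharts g h φ fun c G H φ' x =>
    fBitension G H φ' (fun z => f (c.symm z)) x = 0

end Manifolds

end FBiharm

end

/-!
Subtracting `f τ₂(φ) = 0` from the `f`-biharmonic equation leaves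
`(Δf) τ(φ) + 2 ∇^φ_{grad f} τ(φ) = 0`. As `τ(φ) = m η` is normal, the tangential part is
`A_η (grad f) = 0`, which pseudo-umbilicity turns into `|η|² grad f = 0`: the differential of `f`
vanishes wherever `τ(φ) ≠ 0`. If `df ≠ 0` at some point, then `τ(φ) = 0` on an open set.
The biharmonic equation is a second-order elliptic system for `τ(φ)` whose principal part is the
scalar operator `g^{ij} ∂ᵢ∂ⱼ`, so a Carleman estimate with the convexified weight `e^{lψ}`,
`ψ = -|x - q|²`, gives unique continuation across small spheres. Hence the interior of the zero set
of `τ(φ)` is open and closed, `φ` is minimal, and this contradiction shows `df = 0` on the connected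
manifold `M`.
-/

noncomputable section

namespace FBiharm

/-! ### Calculus with partial derivatives -/

section PartialDerivatives

open MeasureTheory

variable {m : ℕ} {f g : Coord m → ℝ} {X Y : Fin m → Coord m → ℝ}

/-- The partial derivative `∂ᵢf`. -/
def partialDeriv (i : Fin m) (f : Coord m → ℝ) (x : Coord m) : ℝ :=
  fderiv ℝ f x (coordVec i)

/-- The differential of `f` at `x`, as the tuple of the partial derivatives. -/
def differential (f : Coord m → ℝ) (x : Coord m) (i : Fin m) : ℝ :=
  partialDeriv i f x

/-- The derivative `Xf` of a function along a vector field; a vector field is given by the tuple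
of its components. -/
def derivAlong (X : Fin m → Coord m → ℝ) (f : Coord m → ℝ) (x : Coord m) : ℝ :=
  ∑ i, X i x * partialDeriv i f x

/-- The Euclidean divergence of a vector field. -/
def divergence (X : Fin m → Coord m → ℝ) (x : Coord m) : ℝ :=
  ∑ i, partialDeriv i (X i) x

@[fun_prop]
theorem contDiff_partialDeriv (i : Fin m) (hf : ContDiff ℝ ∞ f) :
    ContDiff ℝ ∞ (partialDeriv i f) :=
  (hf.fderiv_right (m := ∞) (by simp)).clm_apply contDiff_const

@[fun_prop]
theorem contDiff_derivAlong (hX : ∀ i, ContDiff ℝ ∞ (X i)) (hf : ContDiff ℝ ∞ f) :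
    ContDiff ℝ ∞ (derivAlong X f) := by
  unfold derivAlong; fun_prop

@[fun_prop]
theorem contDiff_divergence (hX : ∀ i, ContDiff ℝ ∞ (X i)) : ContDiff ℝ ∞ (divergence X) := by
  unfold divergence; fun_prop

theorem differentiableAt_of_contDiff (hf : ContDiff ℝ ∞ f) (x : Coord m) : DifferentiableAt ℝ f x :=
  hf.differentiable (by simp) x

theorem partialDeriv_add (i : Fin m) (hf : ContDiff ℝ ∞ f) (hg : ContDiff ℝ ∞ g) (x : Coord m) :
    partialDeriv i (fun z => f z + g z) x = partialDeriv i f x + partialDeriv i g x := by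
  simp [partialDeriv, fderiv_fun_add (differentiableAt_of_contDiff hf x)
    (differentiableAt_of_contDiff hg x)]

theorem partialDeriv_sub (i : Fin m) (hf : ContDiff ℝ ∞ f) (hg : ContDiff ℝ ∞ g) (x : Coord m) :
    partialDeriv i (fun z => f z - g z) x = partialDeriv i f x - partialDeriv i g x := by
  simp [partialDeriv, fderiv_fun_sub (differentiableAt_of_contDiff hf x)
    (differentiableAt_of_contDiff hg x)]

theorem partialDeriv_mul (i : Fin m) (hf : ContDiff ℝ ∞ f) (hg : ContDiff ℝ ∞ g) (x : Coord m) :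
    partialDeriv i (fun z => f z * g z) x
      = f x * partialDeriv i g x + g x * partialDeriv i f x := by
  simp [partialDeriv, fderiv_fun_mul (differentiableAt_of_contDiff hf x)
    (differentiableAt_of_contDiff hg x)]

theorem partialDeriv_const_mul (i : Fin m) (c : ℝ) (hf : ContDiff ℝ ∞ f) (x : Coord m) :
    partialDeriv i (fun z => c * f z) x = c * partialDeriv i f x := by
  simp [partialDeriv, fderiv_const_mul (differentiableAt_of_contDiff hf x)]

theorem partialDeriv_sum {ι : Type*} (s : Finset ι) (i : Fin m) {F : ι → Coord m → ℝ}
    (hF : ∀ k, ContDiff ℝ ∞ (F k)) (x : Coord m) :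
    partialDeriv i (fun z => ∑ k ∈ s, F k z) x = ∑ k ∈ s, partialDeriv i (F k) x := by
  simp [partialDeriv, fderiv_fun_sum fun k _ => differentiableAt_of_contDiff (hF k) x]

theorem partialDeriv_exp_mul (i : Fin m) (l : ℝ) (hf : ContDiff ℝ ∞ f) (x : Coord m) :
    partialDeriv i (fun z => Real.exp (l * f z)) x
      = l * Real.exp (l * f x) * partialDeriv i f x := by
  have hd := differentiableAt_of_contDiff hf x
  simp [partialDeriv, fderiv_exp (hd.const_mul l), fderiv_const_mul hd]
  ring

theorem partialDeriv_comm (i j : Fin m) (hf : ContDiff ℝ ∞ f) (x : Coord m) :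
    partialDeriv i (partialDeriv j f) x = partialDeriv j (partialDeriv i f) x := by
  have hd : DifferentiableAt ℝ (fderiv ℝ f) x :=
    (hf.fderiv_right (m := ∞) (by simp)).differentiable (by simp) x
  have eq_second (k l : Fin m) : partialDeriv k (partialDeriv l f) x
      = fderiv ℝ (fderiv ℝ f) x (coordVec k) (coordVec l) := by
    change fderiv ℝ (fun z => fderiv ℝ f z (coordVec l)) x (coordVec k) = _
    simp [fderiv_clm_apply hd (differentiableAt_const _)]
  have two_le : (2 : WithTop ℕ∞) ≤ ∞ := WithTop.coe_le_coe.2 le_top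
  rw [eq_second, eq_second]
  exact (hf.contDiffAt.isSymmSndFDerivAt (by simpa using two_le)).eq _ _

theorem partialDeriv_eq_zero_of_notMem_tsupport (i : Fin m) {x : Coord m} (hx : x ∉ tsupport f) :
    partialDeriv i f x = 0 := by
  simp [partialDeriv, fderiv_of_notMem_tsupport ℝ hx]

theorem tsupport_partialDeriv_subset (i : Fin m) (f : Coord m → ℝ) :
    tsupport (partialDeriv i f) ⊆ tsupport f :=
  closure_minimal (Function.support_subset_iff'.2 fun _ hx =>
    partialDeriv_eq_zero_of_notMem_tsupport i hx) (isClosed_tsupport f)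

theorem integrable_partialDeriv (i : Fin m) (hf : ContDiff ℝ ∞ f) (hc : HasCompactSupport f) :
    Integrable (partialDeriv i f) :=
  (contDiff_partialDeriv i hf).continuous.integrable_of_hasCompactSupport
    (hc.mono' ((subset_tsupport _).trans (tsupport_partialDeriv_subset i f)))

theorem integral_partialDeriv_eq_zero (i : Fin m) (hf : ContDiff ℝ ∞ f)
    (hc : HasCompactSupport f) : ∫ x, partialDeriv i f x = 0 := by
  have hint : Integrable f := hf.continuous.integrable_of_hasCompactSupport hc
  simpa [partialDeriv] using integral_mul_fderiv_eq_neg_fderiv_mul_of_integrable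
    (μ := (volume : Measure (Coord m))) (f := fun _ => (1 : ℝ)) (g := f) (v := coordVec i)
    (by simp) (by simp only [one_mul]; exact integrable_partialDeriv i hf hc)
    (by simpa using hint)
    (fun x _ => differentiableAt_const _) (fun x _ => differentiableAt_of_contDiff hf x)

theorem derivAlong_add (X : Fin m → Coord m → ℝ) (hf : ContDiff ℝ ∞ f) (hg : ContDiff ℝ ∞ g)
    (x : Coord m) :
    derivAlong X (fun z => f z + g z) x = derivAlong X f x + derivAlong X g x := by
  simp only [derivAlong, partialDeriv_add _ hf hg, mul_add, Finset.sum_add_distrib]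

theorem derivAlong_sub (X : Fin m → Coord m → ℝ) (hf : ContDiff ℝ ∞ f) (hg : ContDiff ℝ ∞ g)
    (x : Coord m) :
    derivAlong X (fun z => f z - g z) x = derivAlong X f x - derivAlong X g x := by
  simp only [derivAlong, partialDeriv_sub _ hf hg, mul_sub, Finset.sum_sub_distrib]

theorem derivAlong_mul (X : Fin m → Coord m → ℝ) (hf : ContDiff ℝ ∞ f) (hg : ContDiff ℝ ∞ g)
    (x : Coord m) :
    derivAlong X (fun z => f z * g z) x = f x * derivAlong X g x + g x * derivAlong X f x := by
  simp only [derivAlong, partialDeriv_mul _ hf hg, Finset.mul_sum, ← Finset.sum_add_distrib]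
  exact Finset.sum_congr rfl fun i _ => by ring

theorem derivAlong_const_mul (X : Fin m → Coord m → ℝ) (c : ℝ) (hf : ContDiff ℝ ∞ f)
    (x : Coord m) : derivAlong X (fun z => c * f z) x = c * derivAlong X f x := by
  simp only [derivAlong, partialDeriv_const_mul _ c hf, Finset.mul_sum, mul_left_comm]

theorem derivAlong_exp_mul (X : Fin m → Coord m → ℝ) (l : ℝ) (hf : ContDiff ℝ ∞ f)
    (x : Coord m) :
    derivAlong X (fun z => Real.exp (l * f z)) x = l * Real.exp (l * f x) * derivAlong X f x := by
  simp only [derivAlong, partialDeriv_exp_mul _ l hf, Finset.mul_sum, mul_left_comm]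

theorem derivAlong_mul_left (f g : Coord m → ℝ) (X : Fin m → Coord m → ℝ) (x : Coord m) :
    derivAlong (fun i z => f z * X i z) g x = f x * derivAlong X g x := by
  simp only [derivAlong, Finset.mul_sum, mul_assoc]

theorem divergence_add (hX : ∀ i, ContDiff ℝ ∞ (X i)) (hY : ∀ i, ContDiff ℝ ∞ (Y i))
    (x : Coord m) :
    divergence (fun i z => X i z + Y i z) x = divergence X x + divergence Y x := by
  simp only [divergence, partialDeriv_add _ (hX _) (hY _), Finset.sum_add_distrib]

theorem divergence_mul (hf : ContDiff ℝ ∞ f) (hX : ∀ i, ContDiff ℝ ∞ (X i)) (x : Coord m) :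
    divergence (fun i z => f z * X i z) x = f x * divergence X x + derivAlong X f x := by
  simp only [divergence, derivAlong, partialDeriv_mul _ hf (hX _), Finset.sum_add_distrib,
    Finset.mul_sum]

theorem divergence_eq_zero_of_tsupport_subset {K : Set (Coord m)} (hX : ∀ i, tsupport (X i) ⊆ K)
    {x : Coord m} (hx : x ∉ K) : divergence X x = 0 :=
  Finset.sum_eq_zero fun i _ =>
    partialDeriv_eq_zero_of_notMem_tsupport i fun h => hx (hX i h)

theorem integrable_divergence (hX : ∀ i, ContDiff ℝ ∞ (X i))
    (hc : ∀ i, HasCompactSupport (X i)) : Integrable (divergence X) :=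
  integrable_finsetSum _ fun i _ => integrable_partialDeriv i (hX i) (hc i)

theorem integral_divergence_eq_zero (hX : ∀ i, ContDiff ℝ ∞ (X i))
    (hc : ∀ i, HasCompactSupport (X i)) : ∫ x, divergence X x = 0 := by
  unfold divergence
  rw [integral_finsetSum _ fun i _ => integrable_partialDeriv i (hX i) (hc i)]
  exact Finset.sum_eq_zero fun i _ => integral_partialDeriv_eq_zero i (hX i) (hc i)

end PartialDerivatives

/-! ### The Carleman estimate -/

section DivergenceForm

variable {m : ℕ} {a : Fin m → Fin m → Coord m → ℝ} {X : Fin m → Coord m → ℝ} {f g : Coord m → ℝ}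

/-- The flux `∑ⱼ aᵢⱼ ∂ⱼf` of `f` for the coefficients `a`, i.e. its gradient when `a` is the inverse
of a metric. -/
def flux (a : Fin m → Fin m → Coord m → ℝ) (f : Coord m → ℝ) (i : Fin m) (x : Coord m) : ℝ :=
  ∑ j, a i j x * partialDeriv j f x

/-- The divergence form operator `∑ᵢ ∂ᵢ (∑ⱼ aᵢⱼ ∂ⱼf)`. -/
def divFormOp (a : Fin m → Fin m → Coord m → ℝ) (f : Coord m → ℝ) : Coord m → ℝ :=
  divergence (flux a f)

/-- The quadratic form `∑ aᵢⱼ ξᵢ ξⱼ` on covectors. -/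
def quadForm (a : Fin m → Fin m → Coord m → ℝ) (x : Coord m) (ξ : Fin m → ℝ) : ℝ :=
  ∑ i, ∑ j, a i j x * ξ i * ξ j

/-- The deformation form `-½ (ℒ_X a)(ξ, ξ) = ∑ aᵢⱼ ξⱼ (∂ᵢXₖ) ξₖ - ½ ∑ Xₗ (∂ₗaᵢⱼ) ξᵢ ξⱼ` of a vector
field `X` on covectors; it is the Hessian of `ψ` when `X` is the gradient of `ψ`. -/
def deformForm (a : Fin m → Fin m → Coord m → ℝ) (X : Fin m → Coord m → ℝ) (x : Coord m)
    (ξ : Fin m → ℝ) : ℝ :=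
  ∑ i, ∑ k, (∑ j, a i j x * ξ j) * partialDeriv i (X k) x * ξ k
    - 1 / 2 * ∑ l, X l x * quadForm (fun i j => partialDeriv l (a i j)) x ξ

@[fun_prop]
theorem contDiff_flux (ha : ∀ i j, ContDiff ℝ ∞ (a i j)) (hf : ContDiff ℝ ∞ f) (i : Fin m) :
    ContDiff ℝ ∞ (flux a f i) := by
  unfold flux; fun_prop

@[fun_prop]
theorem contDiff_divFormOp (ha : ∀ i j, ContDiff ℝ ∞ (a i j)) (hf : ContDiff ℝ ∞ f) :
    ContDiff ℝ ∞ (divFormOp a f) := by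
  unfold divFormOp; fun_prop

@[fun_prop]
theorem contDiff_quadForm_differential (ha : ∀ i j, ContDiff ℝ ∞ (a i j))
    (hf : ContDiff ℝ ∞ f) : ContDiff ℝ ∞ fun x => quadForm a x (differential f x) := by
  unfold quadForm differential; fun_prop

theorem tsupport_flux_subset (a : Fin m → Fin m → Coord m → ℝ) (f : Coord m → ℝ) (i : Fin m) :
    tsupport (flux a f i) ⊆ tsupport f :=
  closure_minimal (Function.support_subset_iff'.2 fun x hx => by
    simp [flux, partialDeriv_eq_zero_of_notMem_tsupport _ hx]) (isClosed_tsupport f)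

theorem divFormOp_eq_zero_of_notMem_tsupport {x : Coord m} (hx : x ∉ tsupport f) :
    divFormOp a f x = 0 :=
  divergence_eq_zero_of_tsupport_subset (tsupport_flux_subset a f) hx

theorem flux_mul (hf : ContDiff ℝ ∞ f) (hg : ContDiff ℝ ∞ g) (i : Fin m) (x : Coord m) :
    flux a (fun z => f z * g z) i x = f x * flux a g i x + g x * flux a f i x := by
  simp only [flux, partialDeriv_mul _ hf hg, Finset.mul_sum, ← Finset.sum_add_distrib]
  exact Finset.sum_congr rfl fun j _ => by ring

theorem flux_exp_mul (a : Fin m → Fin m → Coord m → ℝ) (l : ℝ) (hf : ContDiff ℝ ∞ f) :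
    (flux a fun z => Real.exp (l * f z))
      = fun i z => l * Real.exp (l * f z) * flux a f i z := by
  funext i x
  simp only [flux, partialDeriv_exp_mul _ l hf, Finset.mul_sum, mul_left_comm]

theorem derivAlong_flux_comm (hsymm : ∀ i j x, a i j x = a j i x) (f g : Coord m → ℝ)
    (x : Coord m) : derivAlong (flux a f) g x = derivAlong (flux a g) f x := by
  simp only [derivAlong, flux, Finset.sum_mul]
  rw [Finset.sum_comm]
  exact Finset.sum_congr rfl fun i _ => Finset.sum_congr rfl fun j _ => by rw [hsymm j i]; ring

theorem derivAlong_flux_self (f : Coord m → ℝ) (x : Coord m) :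
    derivAlong (flux a f) f x = quadForm a x (differential f x) := by
  simp only [derivAlong, flux, quadForm, differential, Finset.sum_mul]
  exact Finset.sum_congr rfl fun i _ => Finset.sum_congr rfl fun j _ => by ring

theorem divFormOp_mul (ha : ∀ i j, ContDiff ℝ ∞ (a i j)) (hsymm : ∀ i j x, a i j x = a j i x)
    (hf : ContDiff ℝ ∞ f) (hg : ContDiff ℝ ∞ g) (x : Coord m) :
    divFormOp a (fun z => f z * g z) x
      = f x * divFormOp a g x + g x * divFormOp a f x + 2 * derivAlong (flux a f) g x := by
  have hflux : flux a (fun z => f z * g z)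
      = fun i z => f z * flux a g i z + g z * flux a f i z := by
    funext i z; exact flux_mul hf hg i z
  rw [divFormOp, hflux, divergence_add (by fun_prop) (by fun_prop),
    divergence_mul hf (by fun_prop), divergence_mul hg (by fun_prop),
    derivAlong_flux_comm hsymm g f, divFormOp, divFormOp]
  ring

theorem divFormOp_exp_mul (ha : ∀ i j, ContDiff ℝ ∞ (a i j)) (l : ℝ) (hf : ContDiff ℝ ∞ f)
    (x : Coord m) :
    divFormOp a (fun z => Real.exp (l * f z)) x
      = Real.exp (l * f x) * (l * divFormOp a f x + l ^ 2 * derivAlong (flux a f) f x) := by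
  rw [divFormOp, flux_exp_mul a l hf, divergence_mul (by fun_prop) (by fun_prop),
    derivAlong_const_mul _ l (by fun_prop), derivAlong_exp_mul _ l hf, divFormOp]
  ring

theorem partialDeriv_derivAlong (hX : ∀ i, ContDiff ℝ ∞ (X i)) (hf : ContDiff ℝ ∞ f) (i : Fin m)
    (x : Coord m) :
    partialDeriv i (derivAlong X f) x
      = ∑ k, partialDeriv i (X k) x * partialDeriv k f x
        + derivAlong X (partialDeriv i f) x := by
  change partialDeriv i (fun z => ∑ k, X k z * partialDeriv k f z) x = _
  rw [partialDeriv_sum _ _ fun k => by fun_prop, derivAlong, ← Finset.sum_add_distrib]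
  refine Finset.sum_congr rfl fun k _ => ?_
  rw [partialDeriv_mul _ (hX k) (by fun_prop), partialDeriv_comm i k hf]
  ring

theorem partialDeriv_quadForm_differential (ha : ∀ i j, ContDiff ℝ ∞ (a i j))
    (hsymm : ∀ i j x, a i j x = a j i x) (hf : ContDiff ℝ ∞ f) (l : Fin m) (x : Coord m) :
    partialDeriv l (fun z => quadForm a z (differential f z)) x
      = quadForm (fun i j => partialDeriv l (a i j)) x (differential f x)
        + 2 * derivAlong (flux a f) (partialDeriv l f) x := by
  have hterm (i j : Fin m) :
      partialDeriv l (fun z => a i j z * differential f z i * differential f z j) x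
        = partialDeriv l (a i j) x * differential f x i * differential f x j
          + a i j x * partialDeriv j f x * partialDeriv i (partialDeriv l f) x
          + a i j x * partialDeriv i f x * partialDeriv j (partialDeriv l f) x := by
    simp only [differential]
    rw [partialDeriv_mul _ (by fun_prop) (by fun_prop), partialDeriv_mul _ (ha i j) (by fun_prop),
      partialDeriv_comm l i hf, partialDeriv_comm l j hf]
    ring
  have hswap : ∑ i, ∑ j, a i j x * partialDeriv i f x * partialDeriv j (partialDeriv l f) x
      = ∑ i, ∑ j, a i j x * partialDeriv j f x * partialDeriv i (partialDeriv l f) x := by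
    rw [Finset.sum_comm]
    exact Finset.sum_congr rfl fun i _ => Finset.sum_congr rfl fun j _ => by rw [hsymm]
  have hsum : partialDeriv l (fun z => quadForm a z (differential f z)) x
      = ∑ i, ∑ j,
        partialDeriv l (fun z => a i j z * differential f z i * differential f z j) x := by
    unfold quadForm differential
    rw [partialDeriv_sum _ _ fun i => by fun_prop]
    exact Finset.sum_congr rfl fun i _ => partialDeriv_sum _ _ (fun j => by fun_prop) x
  rw [hsum]
  simp only [hterm, Finset.sum_add_distrib, hswap, derivAlong, flux, Finset.sum_mul, quadForm]
  ring

/-- The Rellich identity: commuting the flux of `f` with `X` costs the deformation form. -/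
theorem derivAlong_flux_derivAlong (ha : ∀ i j, ContDiff ℝ ∞ (a i j))
    (hsymm : ∀ i j x, a i j x = a j i x) (hX : ∀ i, ContDiff ℝ ∞ (X i)) (hf : ContDiff ℝ ∞ f)
    (x : Coord m) :
    derivAlong (flux a f) (derivAlong X f) x
      = deformForm a X x (differential f x)
        + 1 / 2 * derivAlong X (fun z => quadForm a z (differential f z)) x := by
  have hfirst : ∑ i, flux a f i x * ∑ k, partialDeriv i (X k) x * partialDeriv k f x
      = deformForm a X x (differential f x)
        + 1 / 2 * ∑ l, X l x
          * quadForm (fun i j => partialDeriv l (a i j)) x (differential f x) := by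
    simp only [deformForm, sub_add_cancel, Finset.mul_sum, ← mul_assoc]
    rfl
  have hsecond : ∑ i, flux a f i x * derivAlong X (partialDeriv i f) x
      = ∑ l, X l x * derivAlong (flux a f) (partialDeriv l f) x := by
    simp only [derivAlong, Finset.mul_sum]
    rw [Finset.sum_comm]
    exact Finset.sum_congr rfl fun i _ => Finset.sum_congr rfl fun j _ => by
      rw [partialDeriv_comm i j hf]; ring
  have hquad : derivAlong X (fun z => quadForm a z (differential f z)) x
      = ∑ l, X l x * quadForm (fun i j => partialDeriv l (a i j)) x (differential f x)
        + 2 * ∑ l, X l x * derivAlong (flux a f) (partialDeriv l f) x := by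
    rw [derivAlong]
    simp only [partialDeriv_quadForm_differential ha hsymm hf, mul_add, Finset.sum_add_distrib,
      Finset.mul_sum, mul_left_comm]
  rw [hquad, derivAlong]
  simp only [partialDeriv_derivAlong hX hf, mul_add, Finset.sum_add_distrib, hfirst, hsecond]
  ring

theorem quadForm_smul (x : Coord m) (r : ℝ) (ξ : Fin m → ℝ) :
    quadForm a x (r • ξ) = r ^ 2 * quadForm a x ξ := by
  simp only [quadForm, Pi.smul_apply, smul_eq_mul, Finset.mul_sum]
  exact Finset.sum_congr rfl fun i _ => Finset.sum_congr rfl fun j _ => by ring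

theorem deformForm_smul (X : Fin m → Coord m → ℝ) (x : Coord m) (r : ℝ) (ξ : Fin m → ℝ) :
    deformForm a X x (r • ξ) = r ^ 2 * deformForm a X x ξ := by
  simp only [deformForm, quadForm_smul, Pi.smul_apply, smul_eq_mul, mul_sub]
  congr 1
  · simp only [Finset.mul_sum, Finset.sum_mul]
    exact Finset.sum_congr rfl fun i _ => Finset.sum_congr rfl fun j _ =>
      Finset.sum_congr rfl fun k _ => by ring
  · simp only [Finset.mul_sum]
    exact Finset.sum_congr rfl fun i _ => by ring

theorem deformForm_mul (hf : ContDiff ℝ ∞ f) (hX : ∀ i, ContDiff ℝ ∞ (X i)) (x : Coord m)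
    (ξ : Fin m → ℝ) :
    deformForm a (fun k z => f z * X k z) x ξ
      = f x * deformForm a X x ξ
        + (∑ i, (∑ j, a i j x * ξ j) * partialDeriv i f x) * ∑ k, X k x * ξ k := by
  have hprod : ∑ i, ∑ k, (∑ j, a i j x * ξ j) * partialDeriv i (fun z => f z * X k z) x * ξ k
      = f x * ∑ i, ∑ k, (∑ j, a i j x * ξ j) * partialDeriv i (X k) x * ξ k
        + (∑ i, (∑ j, a i j x * ξ j) * partialDeriv i f x) * ∑ k, X k x * ξ k := by
    rw [Finset.sum_mul_sum, Finset.mul_sum, ← Finset.sum_add_distrib]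
    refine Finset.sum_congr rfl fun i _ => ?_
    rw [Finset.mul_sum, ← Finset.sum_add_distrib]
    refine Finset.sum_congr rfl fun k _ => ?_
    rw [partialDeriv_mul _ hf (hX k)]
    ring
  rw [deformForm, hprod, deformForm]
  simp only [mul_assoc, ← Finset.mul_sum]
  ring

theorem deformForm_flux_exp_mul (ha : ∀ i j, ContDiff ℝ ∞ (a i j))
    (hsymm : ∀ i j x, a i j x = a j i x) (l : ℝ) (hf : ContDiff ℝ ∞ f) (x : Coord m)
    (ξ : Fin m → ℝ) :
    deformForm a (flux a fun z => Real.exp (l * f z)) x ξ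
      = l ^ 2 * Real.exp (l * f x) * (∑ k, flux a f k x * ξ k) ^ 2
        + l * Real.exp (l * f x) * deformForm a (flux a f) x ξ := by
  have hpair : ∑ i, (∑ j, a i j x * ξ j) * partialDeriv i f x = ∑ k, flux a f k x * ξ k := by
    simp only [flux, Finset.sum_mul]
    rw [Finset.sum_comm]
    exact Finset.sum_congr rfl fun i _ => Finset.sum_congr rfl fun j _ => by rw [hsymm j i]; ring
  have hscale (i : Fin m) : partialDeriv i (fun z => l * Real.exp (l * f z)) x
      = l ^ 2 * Real.exp (l * f x) * partialDeriv i f x := by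
    rw [partialDeriv_const_mul _ l (by fun_prop), partialDeriv_exp_mul _ l hf]
    ring
  rw [flux_exp_mul a l hf, deformForm_mul (by fun_prop) (by fun_prop)]
  simp only [hscale, mul_left_comm _ (l ^ 2 * Real.exp (l * f x)), ← Finset.mul_sum, hpair]
  ring

theorem derivAlong_flux_exp_mul (a : Fin m → Fin m → Coord m → ℝ) (l : ℝ) (hf : ContDiff ℝ ∞ f)
    (g : Coord m → ℝ) (x : Coord m) :
    derivAlong (flux a fun z => Real.exp (l * f z)) g x
      = l * Real.exp (l * f x) * derivAlong (flux a f) g x := by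
  rw [flux_exp_mul a l hf, derivAlong_mul_left]

theorem derivAlong_flux_exp_mul_self (a : Fin m → Fin m → Coord m → ℝ) (l : ℝ)
    (hf : ContDiff ℝ ∞ f) (x : Coord m) :
    derivAlong (flux a fun z => Real.exp (l * f z)) (fun z => Real.exp (l * f z)) x
      = l ^ 2 * Real.exp (l * f x) ^ 2 * derivAlong (flux a f) f x := by
  rw [derivAlong_flux_exp_mul a l hf, derivAlong_exp_mul _ l hf]
  ring

theorem derivAlong_derivAlong_flux_exp_mul_self (ha : ∀ i j, ContDiff ℝ ∞ (a i j)) (l : ℝ)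
    (hf : ContDiff ℝ ∞ f) (x : Coord m) :
    let ψ := fun z => Real.exp (l * f z)
    derivAlong (flux a ψ) (derivAlong (flux a ψ) ψ) x
      = l ^ 3 * Real.exp (l * f x) ^ 3
        * (2 * l * derivAlong (flux a f) f x ^ 2
          + derivAlong (flux a f) (derivAlong (flux a f) f) x) := by
  intro ψ
  have hψ : derivAlong (flux a ψ) ψ
      = fun z => l ^ 2 * (Real.exp (2 * l * f z) * derivAlong (flux a f) f z) := by
    funext z
    rw [derivAlong_flux_exp_mul_self a l hf, mul_assoc 2, mul_comm 2, Real.exp_mul (l * f z) 2]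
    norm_cast
    ring
  rw [derivAlong_flux_exp_mul a l hf, hψ, derivAlong_const_mul _ _ (by fun_prop),
    derivAlong_mul _ (by fun_prop) (by fun_prop), derivAlong_exp_mul _ _ hf,
    mul_assoc 2 l (f x), mul_comm 2 (l * f x), Real.exp_mul (l * f x) 2]
  norm_cast
  ring

end DivergenceForm

section CarlemanEstimate

open MeasureTheory

variable {m : ℕ} {a : Fin m → Fin m → Coord m → ℝ} {X : Fin m → Coord m → ℝ}
  {ψ κ A w v : Coord m → ℝ} {K : Set (Coord m)} {c t : ℝ}

/-- The vector field whose divergence is the integrand of the Carleman identity: the multiplier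
`2 Xv + βv` times the flux of `v`, plus the field `X` weighted by `T A v² - a(dv, dv)`. -/
def carlemanField (a : Fin m → Fin m → Coord m → ℝ) (X : Fin m → Coord m → ℝ)
    (A β : Coord m → ℝ) (T : ℝ) (v : Coord m → ℝ) (i : Fin m) (x : Coord m) : ℝ :=
  (2 * derivAlong X v x + β x * v x) * flux a v i x
    + (T * (A x * (v x * v x)) - quadForm a x (differential v x)) * X i x

theorem contDiff_carlemanField {β : Coord m → ℝ} (ha : ∀ i j, ContDiff ℝ ∞ (a i j))
    (hX : ∀ i, ContDiff ℝ ∞ (X i)) (hA : ContDiff ℝ ∞ A) (hβ : ContDiff ℝ ∞ β) (T : ℝ)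
    (hv : ContDiff ℝ ∞ v) (i : Fin m) : ContDiff ℝ ∞ (carlemanField a X A β T v i) := by
  unfold carlemanField; fun_prop

theorem tsupport_carlemanField_subset (a : Fin m → Fin m → Coord m → ℝ)
    (X : Fin m → Coord m → ℝ) (A β : Coord m → ℝ) (T : ℝ) (v : Coord m → ℝ) (i : Fin m) :
    tsupport (carlemanField a X A β T v i) ⊆ tsupport v :=
  closure_minimal (Function.support_subset_iff'.2 fun x hx => by
    simp [carlemanField, flux, quadForm, differential,
      partialDeriv_eq_zero_of_notMem_tsupport _ hx, image_eq_zero_of_notMem_tsupport hx])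
    (isClosed_tsupport v)

theorem divergence_carlemanField (ha : ∀ i j, ContDiff ℝ ∞ (a i j))
    (hsymm : ∀ i j x, a i j x = a j i x) (hX : ∀ i, ContDiff ℝ ∞ (X i)) (hA : ContDiff ℝ ∞ A)
    (hκ : ContDiff ℝ ∞ κ) (T : ℝ) (hv : ContDiff ℝ ∞ v) (x : Coord m) :
    divergence (carlemanField a X A (fun z => divergence X z + κ z) T v) x
      = (divFormOp a v x + T * A x * v x)
          * (2 * derivAlong X v x + (divergence X x + κ x) * v x)
        + (2 * deformForm a X x (differential v x) + κ x * quadForm a x (differential v x))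
        + T * (derivAlong X A x - κ x * A x) * (v x * v x)
        + v x * derivAlong (flux a v) (fun z => divergence X z + κ z) x := by
  set β : Coord m → ℝ := fun z => divergence X z + κ z with hβ
  have hβs : ContDiff ℝ ∞ β := by fun_prop
  have hmultiplier : derivAlong (flux a v) (fun z => 2 * derivAlong X v z + β z * v z) x
      = 2 * deformForm a X x (differential v x)
        + derivAlong X (fun z => quadForm a z (differential v z)) x
        + β x * quadForm a x (differential v x) + v x * derivAlong (flux a v) β x := by
    rw [derivAlong_add _ (by fun_prop) (by fun_prop), derivAlong_const_mul _ _ (by fun_prop),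
      derivAlong_mul _ hβs hv, derivAlong_flux_derivAlong ha hsymm hX hv, derivAlong_flux_self]
    ring
  have hweight : derivAlong X
        (fun z => T * (A z * (v z * v z)) - quadForm a z (differential v z)) x
      = T * (derivAlong X A x * (v x * v x) + 2 * A x * v x * derivAlong X v x)
        - derivAlong X (fun z => quadForm a z (differential v z)) x := by
    rw [derivAlong_sub _ (by fun_prop) (by fun_prop), derivAlong_const_mul _ _ (by fun_prop),
      derivAlong_mul _ hA (by fun_prop), derivAlong_mul _ hv hv]
    ring
  have hfield : carlemanField a X A β T v = fun i z =>
      (2 * derivAlong X v z + β z * v z) * flux a v i z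
        + (T * (A z * (v z * v z)) - quadForm a z (differential v z)) * X i z := rfl
  rw [hfield, divergence_add (by fun_prop) (by fun_prop),
    divergence_mul (by fun_prop) (by fun_prop), divergence_mul (by fun_prop) hX, hmultiplier,
    hweight, divFormOp]
  simp only [hβ]
  ring

/-- The conjugated operator `v ↦ e^{tψ} L (e^{-tψ} v)`, where `L v = ∑ᵢ ∂ᵢ (∑ⱼ aᵢⱼ ∂ⱼv)`. -/
def conjugatedOp (a : Fin m → Fin m → Coord m → ℝ) (ψ : Coord m → ℝ) (t : ℝ)
    (v : Coord m → ℝ) (x : Coord m) : ℝ :=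
  divFormOp a v x - 2 * t * derivAlong (flux a ψ) v x
    + t ^ 2 * derivAlong (flux a ψ) ψ x * v x - t * divFormOp a ψ x * v x

theorem conjugatedOp_exp_mul (ha : ∀ i j, ContDiff ℝ ∞ (a i j))
    (hsymm : ∀ i j x, a i j x = a j i x) (hψ : ContDiff ℝ ∞ ψ) (hw : ContDiff ℝ ∞ w) (t : ℝ)
    (x : Coord m) :
    conjugatedOp a ψ t (fun z => Real.exp (t * ψ z) * w z) x
      = Real.exp (t * ψ x) * divFormOp a w x := by
  rw [conjugatedOp, divFormOp_mul ha hsymm (by fun_prop) hw, divFormOp_exp_mul ha t hψ,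
    derivAlong_flux_exp_mul a t hψ, derivAlong_mul _ (by fun_prop) hw,
    derivAlong_exp_mul _ t hψ]
  ring

/-- `ψ` is a pseudoconvex weight on `K` with multiplier `κ` and constant `c`: both quadratic
expressions that survive in the Carleman identity are bounded below by `c`. -/
structure IsPseudoconvexWeight (a : Fin m → Fin m → Coord m → ℝ) (K : Set (Coord m))
    (ψ κ : Coord m → ℝ) (c : ℝ) : Prop where
  contDiff_weight : ContDiff ℝ ∞ ψ
  contDiff_multiplier : ContDiff ℝ ∞ κ
  pos : 0 < c
  le_deformForm : ∀ x ∈ K, ∀ ξ : Fin m → ℝ,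
    c * ∑ i, ξ i ^ 2 ≤ 4 * deformForm a (flux a ψ) x ξ + 2 * κ x * quadForm a x ξ
  le_derivAlong : ∀ x ∈ K,
    c ≤ derivAlong (flux a ψ) (derivAlong (flux a ψ) ψ) x - κ x * derivAlong (flux a ψ) ψ x

theorem exists_one_le_bound {T : Type*} [TopologicalSpace T] {K : Set T} (hK : IsCompact K)
    {f : T → ℝ} (hf : ContinuousOn f K) : ∃ B : ℝ, 1 ≤ B ∧ ∀ x ∈ K, |f x| ≤ B := by
  obtain ⟨B, hB⟩ := hK.exists_bound_of_continuousOn hf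
  exact ⟨max B 1, le_max_right _ _, fun x hx => (hB x hx).trans (le_max_left _ _)⟩

/-- The divergence identity is used through `-2PS ≤ (P - S)²` for the splitting of the conjugated
operator into a symmetric part `P` and a skew part `S`. -/
theorem le_conjugatedOp_sq (ha : ∀ i j, ContDiff ℝ ∞ (a i j))
    (hsymm : ∀ i j x, a i j x = a j i x) (hψ : ContDiff ℝ ∞ ψ) (hκ : ContDiff ℝ ∞ κ)
    (hv : ContDiff ℝ ∞ v) (t : ℝ) (x : Coord m) :
    let X := flux a ψ
    let A := derivAlong X ψ
    let β := fun z => divergence X z + κ z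
    t * (4 * deformForm a X x (differential v x) + 2 * κ x * quadForm a x (differential v x))
        + 2 * t ^ 3 * (derivAlong X A x - κ x * A x) * v x ^ 2
      ≤ (conjugatedOp a ψ t v x - t * κ x * v x) ^ 2
        + 2 * t * divergence (carlemanField a X A β (t ^ 2) v) x
        - 2 * t * (v x * derivAlong (flux a v) β x) := by
  intro X A β
  have hX (i) : ContDiff ℝ ∞ (X i) := contDiff_flux ha hψ i
  rw [divergence_carlemanField ha hsymm hX (contDiff_derivAlong hX hψ) hκ (t ^ 2) hv x,
    conjugatedOp, divFormOp, divFormOp]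
  change _ ≤ (divFormOp a v x - 2 * t * derivAlong X v x + t ^ 2 * A x * v x
    - t * divergence X x * v x - t * κ x * v x) ^ 2 + _ - _
  change _ ≤ _ + 2 * t * ((divFormOp a v x + _) * _ + _ + _ + _) - _
  nlinarith [sq_nonneg (divFormOp a v x + t ^ 2 * A x * v x),
    sq_nonneg (2 * t * derivAlong X v x + t * (divergence X x + κ x) * v x)]

theorem neg_two_mul_le_of_sq_le {b v B G c : ℝ} (hc : 0 < c) (hB : 0 < B) (hb : b ^ 2 ≤ B * G) :
    -(2 * (v * b)) ≤ c / 2 * G + 2 * B / c * v ^ 2 := by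
  have hquot : c / (2 * B) * b ^ 2 ≤ c / 2 * G := by
    calc c / (2 * B) * b ^ 2 ≤ c / (2 * B) * (B * G) := by gcongr
      _ = c / 2 * G := by field_simp
  have hsq : 0 ≤ c / (2 * B) * (b + 2 * B / c * v) ^ 2 := by positivity
  have hexpand : c / (2 * B) * (b + 2 * B / c * v) ^ 2
      = c / (2 * B) * b ^ 2 + 2 * (v * b) + 2 * B / c * v ^ 2 := by field_simp; ring
  linarith

/-- For large `t` the lower order terms of the conjugated operator are absorbed by the positive
terms of the Carleman identity. -/
theorem absorb_lower_order_terms {c Cκ B G L D Q S κ v b : ℝ} (hc : 0 < c) (hB : 0 < B)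
    (ht1 : 1 ≤ t) (ht : (2 * Cκ + 2 * B / c) / c ≤ t) (hκ : κ ^ 2 ≤ Cκ) (hb : b ^ 2 ≤ B * G)
    (hQ : c * G ≤ Q) (hD : c ≤ D)
    (h : t * Q + 2 * t ^ 3 * D * v ^ 2 ≤ (L - t * κ * v) ^ 2 + 2 * t * S - 2 * t * (v * b)) :
    t * (c / 4 * G) + t ^ 3 * (c / 2) * v ^ 2 ≤ L ^ 2 + t * S := by
  have ht0 : 0 < t := by linarith
  have hgrad : t * (c * G) ≤ t * Q := mul_le_mul_of_nonneg_left hQ ht0.le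
  have hzero : 2 * t ^ 3 * c * v ^ 2 ≤ 2 * t ^ 3 * D * v ^ 2 := by gcongr
  have hmultiplier : (L - t * κ * v) ^ 2 ≤ 2 * L ^ 2 + 2 * (t ^ 2 * (Cκ * v ^ 2)) := by
    have : κ ^ 2 * (t * v) ^ 2 ≤ Cκ * (t * v) ^ 2 := by gcongr
    nlinarith [sq_nonneg (L + t * κ * v)]
  have hcross := mul_le_mul_of_nonneg_left (neg_two_mul_le_of_sq_le (v := v) hc hB hb) ht0.le
  have hcross_sq : t * (2 * B / c * v ^ 2) ≤ t ^ 2 * (2 * B / c * v ^ 2) := by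
    gcongr
    nlinarith
  have hlarge : t ^ 2 * (2 * Cκ + 2 * B / c) * v ^ 2 ≤ t ^ 2 * (t * c) * v ^ 2 := by
    have := (div_le_iff₀ hc).1 ht
    gcongr
  nlinarith

theorem exists_bound_derivAlong_flux_sq (ha : ∀ i j, ContDiff ℝ ∞ (a i j))
    {β : Coord m → ℝ} (hβ : ContDiff ℝ ∞ β) (hK : IsCompact K) :
    ∃ B : ℝ, 1 ≤ B ∧ ∀ x ∈ K, ∀ v : Coord m → ℝ,
      derivAlong (flux a v) β x ^ 2 ≤ B * ∑ i, differential v x i ^ 2 := by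
  obtain ⟨B, hB1, hB⟩ := exists_one_le_bound hK
    (f := fun x => ∑ j, (∑ i, a i j x * partialDeriv i β x) ^ 2)
    (ContDiff.continuous (n := ∞) (by fun_prop)).continuousOn
  refine ⟨B, hB1, fun x hx v => ?_⟩
  have hpair : derivAlong (flux a v) β x
      = ∑ j, (∑ i, a i j x * partialDeriv i β x) * differential v x j := by
    simp only [derivAlong, flux, differential, Finset.sum_mul]
    rw [Finset.sum_comm]
    exact Finset.sum_congr rfl fun i _ => Finset.sum_congr rfl fun j _ => by ring
  rw [hpair]
  refine (Finset.sum_mul_sq_le_sq_mul_sq _ _ _).trans ?_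
  gcongr
  exact (le_abs_self _).trans (hB x hx)

theorem IsPseudoconvexWeight.exists_pointwise_estimate (ha : ∀ i j, ContDiff ℝ ∞ (a i j))
    (hsymm : ∀ i j x, a i j x = a j i x) (hψ : IsPseudoconvexWeight a K ψ κ c)
    (hK : IsCompact K) :
    ∃ t₀ : ℝ, 1 ≤ t₀ ∧ ∀ t ≥ t₀, ∀ v : Coord m → ℝ, ContDiff ℝ ∞ v → ∀ x ∈ K,
      t * (c / 4 * ∑ i, differential v x i ^ 2) + t ^ 3 * (c / 2) * v x ^ 2
        ≤ conjugatedOp a ψ t v x ^ 2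
          + t * divergence (carlemanField a (flux a ψ) (derivAlong (flux a ψ) ψ)
              (fun z => divergence (flux a ψ) z + κ z) (t ^ 2) v) x := by
  have hψs := hψ.contDiff_weight
  have hκs := hψ.contDiff_multiplier
  obtain ⟨Cκ, -, hCκ⟩ := exists_one_le_bound hK (f := fun x => κ x ^ 2)
    (ContDiff.continuous (n := ∞) (by fun_prop)).continuousOn
  obtain ⟨B, hB1, hB⟩ := exists_bound_derivAlong_flux_sq ha
    (β := fun z => divergence (flux a ψ) z + κ z) (by fun_prop) hK
  refine ⟨max 1 ((2 * Cκ + 2 * B / c) / c), le_max_left _ _, fun t ht v hv x hx => ?_⟩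
  exact absorb_lower_order_terms hψ.pos (one_pos.trans_le hB1) ((le_max_left _ _).trans ht)
    ((le_max_right _ _).trans ht) ((le_abs_self _).trans (hCκ x hx)) (hB x hx v)
    (hψ.le_deformForm x hx _) (hψ.le_derivAlong x hx)
    (le_conjugatedOp_sq ha hsymm hψs hκs hv t x)

theorem exp_sq_mul_sum_partialDeriv_sq_le (hψ : ContDiff ℝ ∞ ψ) (hw : ContDiff ℝ ∞ w) {B : ℝ}
    {x : Coord m} (hB : ∑ i, partialDeriv i ψ x ^ 2 ≤ B) (t : ℝ) :
    let v := fun z => Real.exp (t * ψ z) * w z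
    Real.exp (t * ψ x) ^ 2 * ∑ i, partialDeriv i w x ^ 2
      ≤ 2 * ∑ i, differential v x i ^ 2 + 2 * t ^ 2 * (B * v x ^ 2) := by
  intro v
  have hterm (i : Fin m) : Real.exp (t * ψ x) ^ 2 * partialDeriv i w x ^ 2
      ≤ 2 * differential v x i ^ 2 + 2 * t ^ 2 * (partialDeriv i ψ x ^ 2 * v x ^ 2) := by
    have hproduct : Real.exp (t * ψ x) * partialDeriv i w x
        = differential v x i - t * partialDeriv i ψ x * v x := by
      simp only [differential, v]
      rw [partialDeriv_mul _ (by fun_prop) hw, partialDeriv_exp_mul _ _ hψ]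
      ring
    rw [← mul_pow, hproduct]
    nlinarith [sq_nonneg (differential v x i + t * partialDeriv i ψ x * v x)]
  rw [Finset.mul_sum]
  refine (Finset.sum_le_sum fun i _ => hterm i).trans ?_
  rw [Finset.sum_add_distrib, ← Finset.mul_sum, ← Finset.mul_sum, ← Finset.sum_mul]
  gcongr

theorem weighted_energy_le {B c G P V : ℝ} (hB : 1 ≤ B) (hc : 0 < c) (ht : 0 ≤ t) (hG : 0 ≤ G)
    (hV : 0 ≤ V) (hP : P ≤ 2 * G + 2 * t ^ 2 * (B * V)) :
    c / (8 * B) * (t * P + t ^ 3 * V) ≤ t * (c / 4 * G) + t ^ 3 * (c / 2) * V := by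
  have hG' : G ≤ B * G := le_mul_of_one_le_left hG hB
  have hV' : V ≤ B * V := le_mul_of_one_le_left hV hB
  calc c / (8 * B) * (t * P + t ^ 3 * V)
      ≤ c / (8 * B) * (t * (2 * (B * G) + 2 * t ^ 2 * (B * V)) + t ^ 3 * (B * V)) := by
        gcongr
        linarith
    _ = t * (c / 4 * G) + t ^ 3 * (3 * c / 8) * V := by field_simp; ring
    _ ≤ t * (c / 4 * G) + t ^ 3 * (c / 2) * V := by
        have : 3 * c / 8 ≤ c / 2 := by linarith
        gcongr

theorem integral_le_of_le_add_divergence {f g : Coord m → ℝ} {F : Fin m → Coord m → ℝ}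
    (hf : Integrable f) (hg : Integrable g) (hF : ∀ i, ContDiff ℝ ∞ (F i))
    (hFc : ∀ i, HasCompactSupport (F i)) (h : ∀ x, f x ≤ g x + t * divergence F x) :
    ∫ x, f x ≤ ∫ x, g x := by
  have hdiv := (integrable_divergence hF hFc).const_mul t
  calc ∫ x, f x ≤ ∫ x, (g x + t * divergence F x) := integral_mono hf (hg.add hdiv) h
    _ = ∫ x, g x := by
      rw [integral_add hg hdiv, integral_const_mul, integral_divergence_eq_zero hF hFc,
        mul_zero, add_zero]

/-- As `s` does not depend on `t`, large `t` absorbs lower order terms of the operator. -/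
theorem IsPseudoconvexWeight.carleman_estimate (ha : ∀ i j, ContDiff ℝ ∞ (a i j))
    (hsymm : ∀ i j x, a i j x = a j i x) (hψ : IsPseudoconvexWeight a K ψ κ c)
    (hK : IsCompact K) :
    ∃ s > 0, ∃ t₀ : ℝ, 1 ≤ t₀ ∧ ∀ t ≥ t₀, ∀ w : Coord m → ℝ, ContDiff ℝ ∞ w → tsupport w ⊆ K →
      s * ∫ x, Real.exp (t * ψ x) ^ 2 * (t * ∑ i, partialDeriv i w x ^ 2 + t ^ 3 * w x ^ 2)
        ≤ ∫ x, Real.exp (t * ψ x) ^ 2 * divFormOp a w x ^ 2 := by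
  have hψs := hψ.contDiff_weight
  have hκs := hψ.contDiff_multiplier
  obtain ⟨B, hB1, hB⟩ := exists_one_le_bound hK (f := fun x => ∑ i, partialDeriv i ψ x ^ 2)
    (ContDiff.continuous (n := ∞) (by fun_prop)).continuousOn
  obtain ⟨t₀, ht₀, hv⟩ := hψ.exists_pointwise_estimate ha hsymm hK
  have hc := hψ.pos
  refine ⟨c / (8 * B), by positivity, t₀, ht₀, fun t ht w hw hwK => ?_⟩
  have ht0 : 0 ≤ t := by linarith
  set v : Coord m → ℝ := fun z => Real.exp (t * ψ z) * w z
  have hvs : ContDiff ℝ ∞ v := by fun_prop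
  set F := carlemanField a (flux a ψ) (derivAlong (flux a ψ) ψ)
    (fun z => divergence (flux a ψ) z + κ z) (t ^ 2) v
  have hFs (i) : ContDiff ℝ ∞ (F i) :=
    contDiff_carlemanField ha (by fun_prop) (by fun_prop) (by fun_prop) _ hvs i
  have hFw (i) : tsupport (F i) ⊆ tsupport w :=
    (tsupport_carlemanField_subset _ _ _ _ _ v i).trans tsupport_mul_subset_right
  have hwc : HasCompactSupport w := hK.of_isClosed_subset (isClosed_tsupport w) hwK
  have hFc (i) : HasCompactSupport (F i) := hwc.mono' ((subset_tsupport _).trans (hFw i))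
  have hintegrable {g : Coord m → ℝ} (hg : ContDiff ℝ ∞ g) (hgw : ∀ x ∉ tsupport w, g x = 0) :
      Integrable g :=
    hg.continuous.integrable_of_hasCompactSupport (HasCompactSupport.intro hwc.isCompact hgw)
  rw [← integral_const_mul]
  refine integral_le_of_le_add_divergence (t := t) (F := F)
    (hintegrable (by fun_prop) fun x hx => ?_) (hintegrable (by fun_prop) fun x hx => ?_)
    hFs hFc fun x => ?_
  · simp [partialDeriv_eq_zero_of_notMem_tsupport _ hx, image_eq_zero_of_notMem_tsupport hx]
  · simp [divFormOp_eq_zero_of_notMem_tsupport hx]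
  · by_cases hx : x ∈ tsupport w
    · have henergy := weighted_energy_le hB1 hc ht0
        (Finset.sum_nonneg fun i _ => sq_nonneg (differential v x i)) (sq_nonneg (v x))
        (exp_sq_mul_sum_partialDeriv_sq_le hψs hw ((le_abs_self _).trans (hB x (hwK hx))) t)
      have hcarleman := hv t ht v hvs x (hwK hx)
      rw [conjugatedOp_exp_mul ha hsymm hψs hw] at hcarleman
      refine le_trans (le_of_eq ?_) ((henergy.trans hcarleman).trans_eq (by rw [mul_pow]))
      simp only [v]
      ring
    · rw [divergence_eq_zero_of_tsupport_subset hFw hx, divFormOp_eq_zero_of_notMem_tsupport hx]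
      simp [partialDeriv_eq_zero_of_notMem_tsupport _ hx, image_eq_zero_of_notMem_tsupport hx]

end CarlemanEstimate

section UniqueContinuation

open MeasureTheory Filter Topology

variable {m : ℕ} {a : Fin m → Fin m → Coord m → ℝ}

theorem eventually_one_le_add_mul {T : Type*} [TopologicalSpace T] {K : Set T} (hK : IsCompact K)
    {f g : T → ℝ} (hf : ContinuousOn f K) (hg : ContinuousOn g K) (hpos : ∀ x ∈ K, 0 < g x) :
    ∀ᶠ l : ℝ in atTop, ∀ x ∈ K, 1 ≤ f x + l * g x := by
  obtain ⟨c, hc, hcg⟩ := hK.exists_forall_le' hg hpos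
  obtain ⟨B, hB⟩ := hK.exists_bound_of_continuousOn hf
  filter_upwards [eventually_ge_atTop ((B + 1) / c), eventually_ge_atTop 0] with l hl hl0 x hx
  have hfx := (abs_le.1 (hB x hx)).1
  have hlg : B + 1 ≤ l * g x := ((div_le_iff₀ hc).1 hl).trans (by gcongr; exact hcg x hx)
  linarith

theorem isCompact_sum_sq_eq_one : IsCompact {ξ : Fin m → ℝ | ∑ i, ξ i ^ 2 = 1} := by
  refine (isCompact_closedBall (0 : Fin m → ℝ) 1).of_isClosed_subset
    (isClosed_eq (by fun_prop) continuous_const) fun ξ hξ => ?_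
  rw [mem_closedBall_zero_iff, pi_norm_le_iff_of_nonneg zero_le_one]
  intro i
  rw [Real.norm_eq_abs, ← sq_le_one_iff_abs_le_one, ← hξ.out]
  exact Finset.single_le_sum (f := fun i => ξ i ^ 2) (fun i _ => sq_nonneg _) (Finset.mem_univ i)

theorem sum_sq_le_of_one_le {q : (Fin m → ℝ) → ℝ} (hq : ∀ (r : ℝ) ξ, q (r • ξ) = r ^ 2 * q ξ)
    (h : ∀ ξ, ∑ i, ξ i ^ 2 = 1 → 1 ≤ q ξ) (ξ : Fin m → ℝ) : ∑ i, ξ i ^ 2 ≤ q ξ := by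
  have hnonneg : 0 ≤ ∑ i, ξ i ^ 2 := Finset.sum_nonneg fun i _ => sq_nonneg _
  rcases hnonneg.eq_or_lt with hzero | hpos
  · have hξ : ξ = (0 : ℝ) • ξ := by
      ext i
      simpa using (Finset.sum_eq_zero_iff_of_nonneg fun i _ => sq_nonneg (ξ i)).1 hzero.symm i
        (Finset.mem_univ i)
    rw [← hzero, hξ, hq]
    simp
  · have hunit := h ((√(∑ i, ξ i ^ 2))⁻¹ • ξ) (by
      simp only [Pi.smul_apply, smul_eq_mul, mul_pow, ← Finset.mul_sum, inv_pow,
        Real.sq_sqrt hnonneg]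
      exact inv_mul_cancel₀ hpos.ne')
    rwa [hq, inv_pow, Real.sq_sqrt hnonneg, ← div_eq_inv_mul, one_le_div hpos] at hunit

theorem eventually_sum_sq_le_add_mul {K : Set (Coord m)} (hK : IsCompact K)
    {p q : Coord m → (Fin m → ℝ) → ℝ} (hp : Continuous fun y : Coord m × (Fin m → ℝ) => p y.1 y.2)
    (hq : Continuous fun y : Coord m × (Fin m → ℝ) => q y.1 y.2)
    (hp_smul : ∀ x (r : ℝ) ξ, p x (r • ξ) = r ^ 2 * p x ξ)
    (hq_smul : ∀ x (r : ℝ) ξ, q x (r • ξ) = r ^ 2 * q x ξ) (hpos : ∀ x ∈ K, ∀ ξ ≠ 0, 0 < q x ξ) :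
    ∀ᶠ l : ℝ in atTop, ∀ x ∈ K, ∀ ξ, ∑ i, ξ i ^ 2 ≤ p x ξ + l * q x ξ := by
  filter_upwards [eventually_one_le_add_mul (hK.prod isCompact_sum_sq_eq_one) hp.continuousOn
    hq.continuousOn fun y hy => hpos _ hy.1 _ (by rintro h; simpa [h] using hy.2)] with l hl x hx
  exact sum_sq_le_of_one_le (fun r ξ => by rw [hp_smul, hq_smul]; ring) fun ξ hξ =>
    hl (x, ξ) ⟨hx, hξ⟩

/-- Convexification: `exp (l φ)` is a pseudoconvex weight for large `l` when `φ` has no critical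
point on `K`. The multiplier is chosen to cancel half of the dominant term of order `l ^ 4`. -/
theorem exists_isPseudoconvexWeight_exp_mul (ha : ∀ i j, ContDiff ℝ ∞ (a i j))
    (hsymm : ∀ i j x, a i j x = a j i x) {K : Set (Coord m)} (hK : IsCompact K)
    (hpos : ∀ x ∈ K, ∀ ξ ≠ 0, 0 < quadForm a x ξ) {φ : Coord m → ℝ} (hφ : ContDiff ℝ ∞ φ)
    (hcrit : ∀ x ∈ K, differential φ x ≠ 0) :
    ∃ l > 0, ∃ κ c, IsPseudoconvexWeight a K (fun z => Real.exp (l * φ z)) κ c := by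
  set A := derivAlong (flux a φ) φ
  have hA : ∀ x ∈ K, 0 < A x := fun x hx => by
    simpa only [A, derivAlong_flux_self] using hpos x hx _ (hcrit x hx)
  have hac (i j) : Continuous (a i j) := (ha i j).continuous
  have hpa (l i j) : Continuous (partialDeriv l (a i j)) :=
    (contDiff_partialDeriv l (ha i j)).continuous
  have hfc (k) : Continuous (flux a φ k) := (contDiff_flux ha hφ k).continuous
  have hpf (i k) : Continuous (partialDeriv i (flux a φ k)) :=
    (contDiff_partialDeriv i (contDiff_flux ha hφ k)).continuous
  have hAs : ContDiff ℝ ∞ A := by fun_prop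
  have hAc : Continuous A := hAs.continuous
  have hform := eventually_sum_sq_le_add_mul hK
    (p := fun x ξ => 4 * deformForm a (flux a φ) x ξ) (q := fun x ξ => 2 * A x * quadForm a x ξ)
    (by unfold deformForm quadForm; fun_prop) (by unfold quadForm; fun_prop)
    (fun x r ξ => by rw [deformForm_smul]; ring) (fun x r ξ => by rw [quadForm_smul]; ring)
    fun x hx ξ hξ => mul_pos (mul_pos two_pos (hA x hx)) (hpos x hx ξ hξ)
  have hderiv := eventually_one_le_add_mul hK (f := derivAlong (flux a φ) A) (g := fun x => A x ^ 2)
    (ContDiff.continuous (n := ∞) (by fun_prop)).continuousOn (hAc.pow 2).continuousOn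
    fun x hx => pow_pos (hA x hx) 2
  obtain ⟨l, hlform, hlderiv, hl⟩ := (hform.and (hderiv.and (eventually_gt_atTop 0))).exists
  obtain ⟨e₀, he₀, hle⟩ := hK.exists_forall_le' (f := fun x => Real.exp (l * φ x))
    (by have := hφ.continuous; fun_prop) fun x _ => Real.exp_pos _
  refine ⟨l, hl, fun z => l ^ 2 * Real.exp (l * φ z) * A z, min (l * e₀) (l ^ 3 * e₀ ^ 3),
    by fun_prop, by fun_prop, by positivity, fun x hx ξ => ?_, fun x hx => ?_⟩
  · rw [deformForm_flux_exp_mul ha hsymm l hφ]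
    calc min (l * e₀) (l ^ 3 * e₀ ^ 3) * ∑ i, ξ i ^ 2
        ≤ l * Real.exp (l * φ x)
          * (4 * deformForm a (flux a φ) x ξ + l * (2 * A x * quadForm a x ξ)) := by
          gcongr
          exacts [(min_le_left _ _).trans (by gcongr; exact hle x hx), hlform x hx ξ]
      _ ≤ _ := by
          have : 0 ≤ l ^ 2 * Real.exp (l * φ x) * (∑ k, flux a φ k x * ξ k) ^ 2 := by positivity
          linarith
  · rw [derivAlong_derivAlong_flux_exp_mul_self ha l hφ, derivAlong_flux_exp_mul_self a l hφ]
    calc min (l * e₀) (l ^ 3 * e₀ ^ 3) ≤ l ^ 3 * Real.exp (l * φ x) ^ 3 * 1 := by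
          rw [mul_one]
          exact (min_le_right _ _).trans (by gcongr; exact hle x hx)
      _ ≤ l ^ 3 * Real.exp (l * φ x) ^ 3 * (derivAlong (flux a φ) A x + l * A x ^ 2) := by
          gcongr
          exact hlderiv x hx
      _ = _ := by ring

theorem sum_smul_coordVec (v : Coord m) : ∑ i, v i • coordVec i = v := by
  simpa [coordVec] using (EuclideanSpace.basisFun (Fin m) ℝ).sum_repr v

theorem apply_eq_sum_coordVec {W : Type*} [NormedAddCommGroup W] [NormedSpace ℝ W]
    (L : Coord m →L[ℝ] W) (v : Coord m) : L v = ∑ i, v i • L (coordVec i) := by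
  conv_lhs => rw [← sum_smul_coordVec v]
  simp

theorem differential_neg_norm_sub_sq_ne_zero {q x : Coord m} (hx : x ≠ q) :
    differential (fun z => -‖z - q‖ ^ 2) x ≠ 0 := by
  intro h
  have hderiv : fderiv ℝ (fun z : Coord m => -‖z - q‖ ^ 2) x = -(2 • innerSL ℝ (x - q)) := by
    simpa using ((hasFDerivAt_id x).sub_const q).norm_sq.fun_neg.fderiv
  have hzero : fderiv ℝ (fun z : Coord m => -‖z - q‖ ^ 2) x (x - q) = 0 := by
    rw [apply_eq_sum_coordVec]
    exact Finset.sum_eq_zero fun i _ => (congrArg _ (congrFun h i)).trans (smul_zero _)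
  rw [hderiv] at hzero
  simp only [neg_apply, smul_apply, innerSL_apply_apply, neg_eq_zero, smul_eq_zero,
    OfNat.ofNat_ne_zero, false_or, inner_self_eq_zero, sub_eq_zero] at hzero
  exact hx hzero

/-- The first order energy density `|w|² + |∂w|²` of a tuple of functions. -/
def energyDensity {ι : Type*} [Fintype ι] (w : ι → Coord m → ℝ) (x : Coord m) : ℝ :=
  ∑ k, (w k x ^ 2 + ∑ i, partialDeriv i (w k) x ^ 2)

section

variable {ι : Type*} [Fintype ι] {w : ι → Coord m → ℝ}

theorem energyDensity_nonneg (w : ι → Coord m → ℝ) (x : Coord m) : 0 ≤ energyDensity w x := by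
  unfold energyDensity; positivity

@[fun_prop]
theorem contDiff_energyDensity (hw : ∀ k, ContDiff ℝ ∞ (w k)) :
    ContDiff ℝ ∞ (energyDensity w) := by
  unfold energyDensity; fun_prop

theorem integrable_of_forall_notMem {K : Set (Coord m)} (hK : IsCompact K) {f : Coord m → ℝ}
    (hf : ContDiff ℝ ∞ f) (hfK : ∀ x ∉ K, f x = 0) : Integrable f :=
  hf.continuous.integrable_of_hasCompactSupport (HasCompactSupport.intro hK hfK)

theorem energyDensity_eq_zero {x : Coord m} (hx : ∀ k, x ∉ tsupport (w k)) :
    energyDensity w x = 0 := by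
  simp [energyDensity, partialDeriv_eq_zero_of_notMem_tsupport _ (hx _),
    image_eq_zero_of_notMem_tsupport (hx _)]

theorem IsPseudoconvexWeight.mul_integral_energyDensity_le {K : Set (Coord m)}
    {ψ κ : Coord m → ℝ} {c : ℝ} (ha : ∀ i j, ContDiff ℝ ∞ (a i j))
    (hsymm : ∀ i j x, a i j x = a j i x) (hψ : IsPseudoconvexWeight a K ψ κ c)
    (hK : IsCompact K) (hw : ∀ k, ContDiff ℝ ∞ (w k)) (hsupp : ∀ k, tsupport (w k) ⊆ K) :
    ∃ s > 0, ∀ᶠ t : ℝ in atTop,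
      s * t * ∫ x, Real.exp (t * ψ x) ^ 2 * energyDensity w x
        ≤ ∫ x, Real.exp (t * ψ x) ^ 2 * ∑ k, divFormOp a (w k) x ^ 2 := by
  obtain ⟨s, hs, t₀, ht₀, hcarleman⟩ := hψ.carleman_estimate ha hsymm hK
  have hψs := hψ.contDiff_weight
  refine ⟨s, hs, (eventually_ge_atTop t₀).mono fun t ht => ?_⟩
  have hint (k) {f : Coord m → ℝ} (hf : ContDiff ℝ ∞ f) (h0 : ∀ x ∉ tsupport (w k), f x = 0) :
      Integrable f :=
    integrable_of_forall_notMem hK hf fun x hx => h0 x fun h => hx (hsupp k h)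
  simp only [energyDensity, Finset.mul_sum]
  rw [integral_finsetSum _ fun k _ => hint k (by fun_prop) fun x hx => by
      simp [partialDeriv_eq_zero_of_notMem_tsupport _ hx, image_eq_zero_of_notMem_tsupport hx],
    integral_finsetSum _ fun k _ => hint k (by fun_prop) fun x hx => by
      simp [divFormOp_eq_zero_of_notMem_tsupport hx], Finset.mul_sum]
  refine Finset.sum_le_sum fun k _ => le_trans ?_ (hcarleman t ht (w k) (hw k) (hsupp k))
  rw [mul_assoc, ← integral_const_mul]
  refine mul_le_mul_of_nonneg_left (integral_mono (hint k (by fun_prop) fun x hx => ?_)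
    (hint k (by fun_prop) fun x hx => ?_) fun x => ?_) hs.le
  · simp [partialDeriv_eq_zero_of_notMem_tsupport _ hx, image_eq_zero_of_notMem_tsupport hx]
  · simp [partialDeriv_eq_zero_of_notMem_tsupport _ hx, image_eq_zero_of_notMem_tsupport hx]
  · have hpow : t ≤ t ^ 3 := le_self_pow₀ (ht₀.trans ht) (by norm_num)
    calc t * (Real.exp (t * ψ x) ^ 2 * (w k x ^ 2 + ∑ i, partialDeriv i (w k) x ^ 2))
        = Real.exp (t * ψ x) ^ 2 * (t * ∑ i, partialDeriv i (w k) x ^ 2 + t * w k x ^ 2) := by ring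
      _ ≤ _ := by gcongr

end

section

variable {α : Type*} [MeasurableSpace α] {μ : Measure α} {U : Set α} {ψ f g : α → ℝ} {ψ₀ C t : ℝ}

theorem mul_setIntegral_le_integral_exp_sq_mul (hU : MeasurableSet U) (ht : 0 ≤ t)
    (hψU : ∀ x ∈ U, ψ₀ ≤ ψ x) (hg : Integrable g μ) (hg0 : 0 ≤ g)
    (hψg : Integrable (fun x => Real.exp (t * ψ x) ^ 2 * g x) μ) :
    Real.exp (t * ψ₀) ^ 2 * ∫ x in U, g x ∂μ ≤ ∫ x, Real.exp (t * ψ x) ^ 2 * g x ∂μ := by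
  rw [← integral_const_mul]
  refine (setIntegral_mono_on (hg.const_mul _).integrableOn hψg.integrableOn hU
    fun x hx => ?_).trans (setIntegral_le_integral hψg (.of_forall fun x =>
      mul_nonneg (sq_nonneg _) (hg0 x)))
  have := hψU x hx
  have := hg0 x
  gcongr

theorem integral_exp_sq_mul_le (ht : 0 ≤ t) (hC : 0 ≤ C) (hψU : ∀ x ∉ U, ψ x ≤ ψ₀)
    (hfg : ∀ x ∈ U, f x ≤ C * g x) (hf0 : 0 ≤ f) (hg0 : 0 ≤ g) (hf : Integrable f μ)
    (hψf : Integrable (fun x => Real.exp (t * ψ x) ^ 2 * f x) μ)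
    (hψg : Integrable (fun x => Real.exp (t * ψ x) ^ 2 * g x) μ) :
    ∫ x, Real.exp (t * ψ x) ^ 2 * f x ∂μ
      ≤ C * ∫ x, Real.exp (t * ψ x) ^ 2 * g x ∂μ + Real.exp (t * ψ₀) ^ 2 * ∫ x, f x ∂μ := by
  rw [← integral_const_mul, ← integral_const_mul,
    ← integral_add (hψg.const_mul _) (hf.const_mul _)]
  refine integral_mono hψf ((hψg.const_mul _).add (hf.const_mul _)) fun x => ?_
  have hfx := hf0 x
  have hgx := hg0 x
  by_cases hx : x ∈ U
  · calc Real.exp (t * ψ x) ^ 2 * f x ≤ Real.exp (t * ψ x) ^ 2 * (C * g x) := by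
          gcongr; exact hfg x hx
      _ = C * (Real.exp (t * ψ x) ^ 2 * g x) := by ring
      _ ≤ _ := le_add_of_nonneg_right (mul_nonneg (sq_nonneg _) hfx)
  · have := hψU x hx
    calc Real.exp (t * ψ x) ^ 2 * f x ≤ Real.exp (t * ψ₀) ^ 2 * f x := by gcongr
      _ ≤ _ := le_add_of_nonneg_left (mul_nonneg hC (mul_nonneg (sq_nonneg _) hgx))

end

theorem nonpos_of_eventually_mul_le {s C J H : ℝ} (hs : 0 < s)
    (h : ∀ᶠ t : ℝ in atTop, (s * t - C) * J ≤ H) : J ≤ 0 := by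
  by_contra! hJ
  have htop : Tendsto (fun t : ℝ => (s * t - C) * J) atTop atTop :=
    (tendsto_atTop_add_const_right _ (-C) (tendsto_id.const_mul_atTop hs)).atTop_mul_const hJ
  obtain ⟨t, hle, hlt⟩ := (h.and (htop.eventually_gt_atTop H)).exists
  exact hlt.not_ge hle

/-- Unique continuation across a level set of the weight: in `U` the Carleman estimate absorbs the
lower order terms, and the remaining term is of size `exp (t ψ₀) ^ 2`, which loses against the
energy in `U` as `t → ∞`. -/
theorem IsPseudoconvexWeight.eqOn_zero {ι : Type*} [Fintype ι] {w : ι → Coord m → ℝ}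
    {K U : Set (Coord m)} {ψ κ : Coord m → ℝ} {c C ψ₀ : ℝ} (ha : ∀ i j, ContDiff ℝ ∞ (a i j))
    (hsymm : ∀ i j x, a i j x = a j i x) (hψ : IsPseudoconvexWeight a K ψ κ c)
    (hK : IsCompact K) (hw : ∀ k, ContDiff ℝ ∞ (w k)) (hsupp : ∀ k, tsupport (w k) ⊆ K)
    (hU : IsOpen U) (hψU : ∀ x ∈ U, ψ₀ ≤ ψ x) (hψU' : ∀ x ∉ U, ψ x ≤ ψ₀) (hC : 0 ≤ C)
    (hle : ∀ x ∈ U, ∑ k, divFormOp a (w k) x ^ 2 ≤ C * energyDensity w x) (k : ι) :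
    Set.EqOn (w k) 0 U := by
  have hψs := hψ.contDiff_weight
  obtain ⟨s, hs, hcarleman⟩ := hψ.mul_integral_energyDensity_le ha hsymm hK hw hsupp
  set f := fun x => ∑ k, divFormOp a (w k) x ^ 2
  have hf0 : 0 ≤ f := fun x => Finset.sum_nonneg fun k _ => sq_nonneg _
  have hf (x) (hx : x ∉ K) : f x = 0 := by
    simp [f, divFormOp_eq_zero_of_notMem_tsupport fun h => hx (hsupp _ h)]
  have hE (x) (hx : x ∉ K) : energyDensity w x = 0 :=
    energyDensity_eq_zero fun k h => hx (hsupp k h)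
  have hfint : Integrable f := integrable_of_forall_notMem hK (by fun_prop) hf
  have hEint : Integrable (energyDensity w) := integrable_of_forall_notMem hK (by fun_prop) hE
  have hψf (t : ℝ) : Integrable fun x => Real.exp (t * ψ x) ^ 2 * f x :=
    integrable_of_forall_notMem hK (by fun_prop) fun x hx => by simp [hf x hx]
  have hψE (t : ℝ) : Integrable fun x => Real.exp (t * ψ x) ^ 2 * energyDensity w x :=
    integrable_of_forall_notMem hK (by fun_prop) fun x hx => by simp [hE x hx]
  have hJ : ∫ x in U, energyDensity w x ≤ 0 := by
    refine nonpos_of_eventually_mul_le (C := C) (H := ∫ x, f x) hs ?_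
    filter_upwards [hcarleman, eventually_ge_atTop 0, eventually_ge_atTop (C / s)] with t hct ht htC
    have hst : 0 ≤ s * t - C := by linarith [(div_le_iff₀' hs).1 htC]
    have hlower := mul_le_mul_of_nonneg_left (mul_setIntegral_le_integral_exp_sq_mul
      hU.measurableSet ht hψU hEint (energyDensity_nonneg w) (hψE t)) hst
    have hupper := integral_exp_sq_mul_le ht hC hψU' hle hf0 (energyDensity_nonneg w) hfint
      (hψf t) (hψE t)
    refine le_of_mul_le_mul_left ?_ (by positivity : 0 < Real.exp (t * ψ₀) ^ 2)
    linarith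
  intro x hx
  have hae := (setIntegral_eq_zero_iff_of_nonneg_ae (.of_forall (energyDensity_nonneg w))
    hEint.integrableOn).1
    (hJ.antisymm (integral_nonneg (energyDensity_nonneg w)))
  have hEx : energyDensity w x = 0 := Measure.eqOn_open_of_ae_eq hae hU
    (contDiff_energyDensity hw).continuous.continuousOn continuousOn_const hx
  have hwx := (Finset.sum_eq_zero_iff_of_nonneg fun k _ => by positivity).1 hEx k
    (Finset.mem_univ k)
  exact pow_eq_zero_iff two_ne_zero |>.1
    ((add_eq_zero_iff_of_nonneg (sq_nonneg _) (by positivity)).1 hwx).1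

theorem eqOn_zero_ball_of_tsupport_subset {ι : Type*} [Fintype ι] {w : ι → Coord m → ℝ}
    (ha : ∀ i j, ContDiff ℝ ∞ (a i j)) (hsymm : ∀ i j x, a i j x = a j i x) {q : Coord m}
    {r ρ R C : ℝ} (hr : 0 < r) (hρ : 0 < ρ)
    (hpos : ∀ x ∈ Metric.closedBall q R, ∀ ξ ≠ 0, 0 < quadForm a x ξ)
    (hw : ∀ k, ContDiff ℝ ∞ (w k))
    (hsupp : ∀ k, tsupport (w k) ⊆ Metric.closedBall q R \ Metric.ball q r) (hC : 0 ≤ C)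
    (hle : ∀ x ∈ Metric.ball q ρ,
      ∑ k, divFormOp a (w k) x ^ 2 ≤ C * energyDensity w x) (k : ι) :
    Set.EqOn (w k) 0 (Metric.ball q ρ) := by
  have hK : IsCompact (Metric.closedBall q R \ Metric.ball q r) :=
    (isCompact_closedBall q R).diff Metric.isOpen_ball
  obtain ⟨l, hl, κ, c, hψ⟩ := exists_isPseudoconvexWeight_exp_mul ha hsymm hK
    (fun x hx => hpos x hx.1) (φ := fun z => -‖z - q‖ ^ 2)
    ((contDiff_id.sub contDiff_const).norm_sq ℝ).neg
    fun x hx => differential_neg_norm_sub_sq_ne_zero (by rintro rfl; exact hx.2 (by simpa using hr))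
  refine hψ.eqOn_zero ha hsymm hK hw hsupp Metric.isOpen_ball (ψ₀ := Real.exp (l * -ρ ^ 2))
    (fun x hx => ?_) (fun x hx => ?_) hC hle k
  · rw [Metric.mem_ball, dist_eq_norm] at hx
    gcongr
  · rw [Metric.mem_ball, not_lt, dist_eq_norm] at hx
    gcongr

end UniqueContinuation

section EllipticSystems

open Filter Topology

variable {m n : ℕ}

/-- The second order operator `∑ aᵢⱼ ∂ᵢ∂ⱼV` with scalar coefficients acting on a vector valued
function `V`. -/
def principalPart {W : Type*} [NormedAddCommGroup W] [NormedSpace ℝ W]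
    (a : Fin m → Fin m → Coord m → ℝ) (V : Coord m → W) (x : Coord m) : W :=
  ∑ i, ∑ j, a i j x • fderiv ℝ (fun z => fderiv ℝ V z (coordVec j)) x (coordVec i)

theorem principalPart_congr {W : Type*} [NormedAddCommGroup W] [NormedSpace ℝ W]
    {a b : Fin m → Fin m → Coord m → ℝ} {U V : Coord m → W} {x : Coord m}
    (hab : ∀ i j, a i j x = b i j x) (hUV : U =ᶠ[𝓝 x] V) :
    principalPart a U x = principalPart b V x := by
  have hderiv (j : Fin m) : (fun z => fderiv ℝ U z (coordVec j))
      =ᶠ[𝓝 x] fun z => fderiv ℝ V z (coordVec j) :=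
    hUV.fderiv.fun_comp fun L => L (coordVec j)
  simp only [principalPart, hab, (hderiv _).fderiv_eq]

theorem norm_sq_le_sum_norm_apply_coordVec_sq {W : Type*} [NormedAddCommGroup W] [NormedSpace ℝ W]
    (L : Coord m →L[ℝ] W) : ‖L‖ ^ 2 ≤ ∑ i, ‖L (coordVec i)‖ ^ 2 := by
  have h0 : 0 ≤ ∑ i, ‖L (coordVec i)‖ ^ 2 := by positivity
  rw [← Real.sq_sqrt h0]
  refine pow_le_pow_left₀ (norm_nonneg _) (L.opNorm_le_bound (Real.sqrt_nonneg _) fun v => ?_) 2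
  rw [apply_eq_sum_coordVec L v]
  refine (norm_sum_le _ _).trans ?_
  rw [EuclideanSpace.norm_eq, mul_comm, ← Real.sqrt_mul (by positivity)]
  refine Real.le_sqrt_of_sq_le ?_
  simp only [norm_smul]
  exact Finset.sum_mul_sq_le_sq_mul_sq _ _ _

theorem contDiff_smul_of_tsupport_subset {E W : Type*} [NormedAddCommGroup E] [NormedSpace ℝ E]
    [NormedAddCommGroup W] [NormedSpace ℝ W] {Ω : Set E} (hΩ : IsOpen Ω) {χ : E → ℝ} {f : E → W}
    (hχ : ContDiff ℝ ∞ χ) (hs : tsupport χ ⊆ Ω) (hf : ContDiffOn ℝ ∞ f Ω) :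
    ContDiff ℝ ∞ fun x => χ x • f x := by
  rw [contDiff_iff_contDiffAt]
  intro x
  by_cases hx : x ∈ Ω
  · exact hχ.contDiffAt.smul (hf.contDiffAt (hΩ.mem_nhds hx))
  · have hzero : (fun x => χ x • f x) =ᶠ[𝓝 x] fun _ => 0 := by
      filter_upwards [notMem_tsupport_iff_eventuallyEq.1 fun h => hx (hs h)] with y hy
      simp [hy]
    exact contDiffAt_const.congr_of_eventuallyEq hzero

theorem partialDeriv_apply {V : Coord m → Coord n} {x : Coord m} (hV : DifferentiableAt ℝ V x)
    (i : Fin m) (k : Fin n) :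
    partialDeriv i (fun z => V z k) x = fderiv ℝ V x (coordVec i) k := by
  have hcomp := ((EuclideanSpace.proj k : Coord n →L[ℝ] ℝ).hasFDerivAt.comp x hV.hasFDerivAt).fderiv
  exact congrArg (· (coordVec i)) hcomp

theorem divFormOp_eq_sum {a : Fin m → Fin m → Coord m → ℝ} (ha : ∀ i j, ContDiff ℝ ∞ (a i j))
    {v : Coord m → ℝ} (hv : ContDiff ℝ ∞ v) (x : Coord m) :
    divFormOp a v x = ∑ i, ∑ j, a i j x * partialDeriv i (partialDeriv j v) x
      + ∑ j, partialDeriv j v x * ∑ i, partialDeriv i (a i j) x := by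
  have hflux (i : Fin m) : partialDeriv i (flux a v i) x
      = ∑ j, (a i j x * partialDeriv i (partialDeriv j v) x
        + partialDeriv j v x * partialDeriv i (a i j) x) := by
    unfold flux
    rw [partialDeriv_sum _ _ fun k => by fun_prop]
    exact Finset.sum_congr rfl fun j _ => partialDeriv_mul _ (ha i j) (by fun_prop) x
  simp only [divFormOp, divergence, hflux, Finset.sum_add_distrib, Finset.mul_sum]
  congr 1
  exact Finset.sum_comm

theorem divFormOp_apply {a : Fin m → Fin m → Coord m → ℝ} (ha : ∀ i j, ContDiff ℝ ∞ (a i j))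
    {V : Coord m → Coord n} (hV : ContDiff ℝ ∞ V) (x : Coord m) (k : Fin n) :
    divFormOp a (fun z => V z k) x = principalPart a V x k
      + ∑ j, partialDeriv j (fun z => V z k) x * ∑ i, partialDeriv i (a i j) x := by
  have hVd : Differentiable ℝ V := hV.differentiable (by simp)
  have hDVd (j : Fin m) : Differentiable ℝ fun z => fderiv ℝ V z (coordVec j) :=
    ((hV.fderiv_right (m := ∞) (by simp)).clm_apply contDiff_const).differentiable (by simp)
  have hfirst (j : Fin m) :
      partialDeriv j (fun z => V z k) = fun z => fderiv ℝ V z (coordVec j) k :=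
    funext fun z => partialDeriv_apply (hVd z) j k
  rw [divFormOp_eq_sum ha (contDiff_euclidean.1 hV k)]
  simp only [principalPart, hfirst, partialDeriv_apply (hDVd _ _)]
  simp

theorem norm_sq_add_norm_fderiv_sq_le_energyDensity {V : Coord m → Coord n} {x : Coord m}
    (hV : DifferentiableAt ℝ V x) :
    ‖V x‖ ^ 2 + ‖fderiv ℝ V x‖ ^ 2 ≤ energyDensity (fun k z => V z k) x := by
  rw [energyDensity, Finset.sum_add_distrib, ← EuclideanSpace.real_norm_sq_eq, Finset.sum_comm]
  simp only [partialDeriv_apply hV, ← EuclideanSpace.real_norm_sq_eq]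
  gcongr
  exact norm_sq_le_sum_norm_apply_coordVec_sq _

theorem sum_divFormOp_sq_le {a : Fin m → Fin m → Coord m → ℝ} (ha : ∀ i j, ContDiff ℝ ∞ (a i j))
    {V : Coord m → Coord n} (hV : ContDiff ℝ ∞ V) {x : Coord m} {B C : ℝ}
    (hB : ∑ j, (∑ i, partialDeriv i (a i j) x) ^ 2 ≤ B)
    (hle : ‖principalPart a V x‖ ≤ C * (‖V x‖ + ‖fderiv ℝ V x‖)) :
    ∑ k, divFormOp a (fun z => V z k) x ^ 2
      ≤ (4 * C ^ 2 + 2 * B) * energyDensity (fun k z => V z k) x := by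
  have hB0 : 0 ≤ B := (Finset.sum_nonneg fun j _ => sq_nonneg _).trans hB
  have hlower (k : Fin n) :
      (∑ j, partialDeriv j (fun z => V z k) x * ∑ i, partialDeriv i (a i j) x) ^ 2
        ≤ B * (V x k ^ 2 + ∑ j, partialDeriv j (fun z => V z k) x ^ 2) := by
    refine (Finset.sum_mul_sq_le_sq_mul_sq _ _ _).trans ?_
    rw [mul_comm]
    gcongr
    exact le_add_of_nonneg_left (sq_nonneg _)
  have hprincipal : ‖principalPart a V x‖ ^ 2 ≤ 2 * C ^ 2 * energyDensity (fun k z => V z k) x :=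
    calc ‖principalPart a V x‖ ^ 2 ≤ (C * (‖V x‖ + ‖fderiv ℝ V x‖)) ^ 2 := by gcongr
      _ = C ^ 2 * (‖V x‖ + ‖fderiv ℝ V x‖) ^ 2 := mul_pow _ _ _
      _ ≤ C ^ 2 * (2 * (‖V x‖ ^ 2 + ‖fderiv ℝ V x‖ ^ 2)) := by gcongr; exact add_sq_le
      _ ≤ C ^ 2 * (2 * energyDensity (fun k z => V z k) x) := by
        gcongr
        exact norm_sq_add_norm_fderiv_sq_le_energyDensity (hV.differentiable (by simp) x)
      _ = _ := by ring
  calc ∑ k, divFormOp a (fun z => V z k) x ^ 2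
      ≤ ∑ k, (2 * principalPart a V x k ^ 2
          + 2 * (B * (V x k ^ 2 + ∑ j, partialDeriv j (fun z => V z k) x ^ 2))) := by
        gcongr with k
        rw [divFormOp_apply ha hV, ← mul_add]
        exact add_sq_le.trans (by gcongr; exact hlower k)
    _ = 2 * ‖principalPart a V x‖ ^ 2 + 2 * (B * energyDensity (fun k z => V z k) x) := by
        rw [Finset.sum_add_distrib, EuclideanSpace.real_norm_sq_eq, energyDensity]
        simp only [Finset.mul_sum]
    _ ≤ _ := by linarith

theorem exists_contDiff_symm_eqOn {Ω : Set (Coord m)} (hΩ : IsOpen Ω)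
    {a : Fin m → Fin m → Coord m → ℝ} (ha : ∀ i j, ContDiffOn ℝ ∞ (a i j) Ω)
    (hsymm : ∀ i j, ∀ x ∈ Ω, a i j x = a j i x) {q : Coord m} {R R' : ℝ} (hR : 0 < R)
    (hR' : R < R') (hball : Metric.closedBall q R' ⊆ Ω) :
    ∃ b : Fin m → Fin m → Coord m → ℝ, (∀ i j, ContDiff ℝ ∞ (b i j)) ∧
      (∀ i j x, b i j x = b j i x) ∧ ∀ i j, Set.EqOn (b i j) (a i j) (Metric.closedBall q R) := by
  let χ : ContDiffBump q := ⟨R, R', hR, hR'⟩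
  have hχΩ : tsupport χ ⊆ Ω := χ.tsupport_eq ▸ hball
  refine ⟨fun i j x => χ x • a i j x,
    fun i j => contDiff_smul_of_tsupport_subset hΩ χ.contDiff hχΩ (ha i j),
    fun i j x => ?_, fun i j x hx => ?_⟩
  · by_cases hx : x ∈ Ω
    · simp only [hsymm i j x hx]
    · simp only [image_eq_zero_of_notMem_tsupport fun h => hx (hχΩ h), zero_smul]
  · simp only [χ.one_of_mem_closedBall hx, one_smul]

/-- Extending the coefficients from a ball and cutting `V` off reduces this to globally defined
functions supported in an annulus. -/
theorem eqOn_zero_ball_of_norm_principalPart_le {Ω : Set (Coord m)} (hΩ : IsOpen Ω)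
    {a : Fin m → Fin m → Coord m → ℝ} (ha : ∀ i j, ContDiffOn ℝ ∞ (a i j) Ω)
    (hsymm : ∀ i j, ∀ x ∈ Ω, a i j x = a j i x) (hpos : ∀ x ∈ Ω, ∀ ξ ≠ 0, 0 < quadForm a x ξ)
    {V : Coord m → Coord n} (hV : ContDiffOn ℝ ∞ V Ω) {q : Coord m} {r ρ R R' : ℝ} (hr : 0 < r)
    (hρ : 0 < ρ) (hR : ρ < R) (hR' : R < R') (hball : Metric.closedBall q R' ⊆ Ω) {C : ℝ}
    (hle : ∀ x ∈ Metric.ball q ρ,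
      ‖principalPart a V x‖ ≤ C * (‖V x‖ + ‖fderiv ℝ V x‖))
    (hzero : Set.EqOn V 0 (Metric.ball q r)) : Set.EqOn V 0 (Metric.ball q ρ) := by
  obtain ⟨b, hb, hbsymm, hba⟩ := exists_contDiff_symm_eqOn hΩ ha hsymm (hρ.trans hR) hR' hball
  let η : ContDiffBump q := ⟨ρ, R, hρ, hR⟩
  have hηR : tsupport η ⊆ Metric.closedBall q R := η.tsupport_eq.subset
  have hRΩ : Metric.closedBall q R ⊆ Ω := (Metric.closedBall_subset_closedBall hR'.le).trans hball
  have hρR : Metric.ball q ρ ⊆ Metric.closedBall q R :=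
    Metric.ball_subset_closedBall.trans (Metric.closedBall_subset_closedBall hR.le)
  set W : Coord m → Coord n := fun x => η x • V x
  have hW : ContDiff ℝ ∞ W := contDiff_smul_of_tsupport_subset hΩ η.contDiff (hηR.trans hRΩ) hV
  have hWV {x} (hx : x ∈ Metric.ball q ρ) : W =ᶠ[𝓝 x] V := by
    filter_upwards [Metric.isOpen_ball.mem_nhds hx] with y hy
    simp only [W, η.one_of_mem_closedBall (Metric.ball_subset_closedBall hy), one_smul]
  have hsupp (k) : tsupport (fun x => W x k) ⊆ Metric.closedBall q R \ Metric.ball q r :=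
    fun x hx => ⟨hηR (tsupport_mul_subset_left (f := η) hx), fun hxr =>
      notMem_tsupport_iff_eventuallyEq.2 (by
        filter_upwards [Metric.isOpen_ball.mem_nhds hxr] with y hy
        simp [W, hzero hy]) hx⟩
  obtain ⟨B, hB1, hB⟩ := exists_one_le_bound (isCompact_closedBall q R)
    (f := fun x => ∑ j, (∑ i, partialDeriv i (b i j) x) ^ 2)
    (ContDiff.continuous (n := ∞) (by fun_prop)).continuousOn
  intro x hx
  rw [← (hWV hx).eq_of_nhds]
  ext k
  refine eqOn_zero_ball_of_tsupport_subset hb hbsymm hr hρ (fun y hy ξ hξ => ?_)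
    (contDiff_euclidean.1 hW) hsupp (C := 4 * C ^ 2 + 2 * B) (by positivity) (fun y hy => ?_) k hx
  · simpa only [quadForm, hba _ _ hy] using hpos y (hRΩ hy) ξ hξ
  · refine sum_divFormOp_sq_le hb hW ((le_abs_self _).trans (hB y (hρR hy))) ?_
    rw [principalPart_congr (fun i j => hba i j (hρR hy)) (hWV hy), (hWV hy).eq_of_nhds,
      (hWV hy).fderiv_eq]
    exact hle y hy

end EllipticSystems

/-! ### Riemannian geometry in coordinates -/

section InnerProducts

open scoped Matrix

variable {m : ℕ} {B B' : Coord m →L[ℝ] Coord m →L[ℝ] ℝ}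

/-- The bilinear form `B` is an inner product: the value of a Riemannian metric at a point. -/
structure IsInnerProduct (B : Coord m →L[ℝ] Coord m →L[ℝ] ℝ) : Prop where
  symm : ∀ v w, B v w = B w v
  pos : ∀ v, v ≠ 0 → 0 < B v v

theorem IsInnerProduct.ext_left (hB : IsInnerProduct B) {u v : Coord m}
    (h : ∀ l, B u l = B v l) : u = v := by
  by_contra hne
  have hpos := hB.pos (u - v) (sub_ne_zero.2 hne)
  rw [map_sub B, sub_apply, h, sub_self] at hpos
  exact hpos.false

/-- The Gram matrix of a bilinear form in the coordinate basis; for the value of a metric at a point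
this is the matrix `g_{ij}`. -/
def gram (B : Coord m →L[ℝ] Coord m →L[ℝ] ℝ) : Matrix (Fin m) (Fin m) ℝ :=
  Matrix.of fun i j => B (coordVec i) (coordVec j)

theorem inverseMetric_eq (G : Coord m → Coord m →L[ℝ] Coord m →L[ℝ] ℝ) (x : Coord m) :
    inverseMetric G x = (gram (G x))⁻¹ := rfl

theorem apply_eq_sum_gram (B : Coord m →L[ℝ] Coord m →L[ℝ] ℝ) (v w : Coord m) :
    B v w = ∑ i, ∑ j, v i * w j * gram B i j := by
  rw [apply_eq_sum_coordVec B v, sum_apply]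
  refine Finset.sum_congr rfl fun i _ => ?_
  rw [smul_apply, apply_eq_sum_coordVec (B (coordVec i)) w, Finset.smul_sum]
  simp only [smul_eq_mul, mul_assoc, gram, Matrix.of_apply]

theorem IsInnerProduct.posDef_gram (hB : IsInnerProduct B) : (gram B).PosDef := by
  refine Matrix.PosDef.of_dotProduct_mulVec_pos (Matrix.IsHermitian.ext fun i j => hB.symm _ _)
    fun v hv => ?_
  refine (hB.pos (WithLp.toLp 2 v) ((WithLp.toLp_eq_zero 2).not.2 hv)).trans_eq ?_
  rw [apply_eq_sum_gram]
  simp only [dotProduct, Matrix.mulVec, Finset.mul_sum, star_trivial]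
  exact Finset.sum_congr rfl fun i _ => Finset.sum_congr rfl fun j _ => by ring

theorem IsInnerProduct.isUnit_det_gram (hB : IsInnerProduct B) : IsUnit (gram B).det :=
  hB.posDef_gram.det_pos.ne'.isUnit

theorem IsInnerProduct.inv_gram_symm (hB : IsInnerProduct B) (i j : Fin m) :
    (gram B)⁻¹ i j = (gram B)⁻¹ j i :=
  hB.posDef_gram.inv.isHermitian.apply j i

theorem IsInnerProduct.inv_gram_pos (hB : IsInnerProduct B) {ξ : Fin m → ℝ} (hξ : ξ ≠ 0) :
    0 < ∑ i, ∑ j, (gram B)⁻¹ i j * ξ i * ξ j := by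
  refine (hB.posDef_gram.inv.dotProduct_mulVec_pos hξ).trans_eq ?_
  simp only [dotProduct, Matrix.mulVec, Finset.mul_sum, star_trivial]
  exact Finset.sum_congr rfl fun i _ => Finset.sum_congr rfl fun j _ => by ring

/-- The musical isomorphism `α ↦ α♯` of `B`: the vector with components `∑ⱼ g^{ij} αⱼ`. -/
def sharp (B : Coord m →L[ℝ] Coord m →L[ℝ] ℝ) (α : Fin m → ℝ) : Coord m :=
  ∑ i, (∑ j, (gram B)⁻¹ i j * α j) • coordVec i

theorem IsInnerProduct.sharp_apply_coordVec (hB : IsInnerProduct B) (α : Fin m → ℝ) (l : Fin m) :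
    B (sharp B α) (coordVec l) = α l :=
  calc B (sharp B α) (coordVec l) = (gram B *ᵥ (gram B)⁻¹ *ᵥ α) l := by
        rw [sharp, map_sum, sum_apply]
        refine Finset.sum_congr rfl fun i _ => ?_
        rw [map_smul, smul_apply, smul_eq_mul, mul_comm, hB.symm]
        rfl
    _ = α l := by
        rw [Matrix.mulVec_mulVec, Matrix.mul_nonsing_inv _ hB.isUnit_det_gram, Matrix.one_mulVec]

theorem IsInnerProduct.sharp_apply (hB : IsInnerProduct B) (α : Coord m →L[ℝ] ℝ) (l : Coord m) :
    B (sharp B fun j => α (coordVec j)) l = α l := by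
  rw [apply_eq_sum_coordVec _ l, apply_eq_sum_coordVec α l]
  simp only [hB.sharp_apply_coordVec]

theorem IsInnerProduct.sharp_eq (hB : IsInnerProduct B) {u : Coord m} {α : Fin m → ℝ}
    (h : ∀ j, B u (coordVec j) = α j) : sharp B α = u := by
  refine hB.ext_left fun l => ?_
  rw [← funext h, hB.sharp_apply]

theorem sharp_add (B : Coord m →L[ℝ] Coord m →L[ℝ] ℝ) (α β : Fin m → ℝ) :
    sharp B (α + β) = sharp B α + sharp B β := by
  simp only [sharp, Pi.add_apply, mul_add, add_smul, Finset.sum_add_distrib]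

theorem sharp_smul (B : Coord m →L[ℝ] Coord m →L[ℝ] ℝ) (c : ℝ) (α : Fin m → ℝ) :
    sharp B (c • α) = c • sharp B α := by
  simp only [sharp, Pi.smul_apply, smul_eq_mul, Finset.smul_sum, smul_smul, Finset.mul_sum,
    mul_left_comm]

theorem inv_gram_eq_sum_of_isometry (hB' : IsInnerProduct B') (P : Coord m →L[ℝ] Coord m)
    (hP : ∀ v w, B' v w = B (P v) (P w)) (k l : Fin m) :
    (gram B)⁻¹ k l = ∑ i, ∑ j, (gram B')⁻¹ i j * P (coordVec i) k * P (coordVec j) l := by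
  set Q : Matrix (Fin m) (Fin m) ℝ := Matrix.of fun i j => P (coordVec j) i with hQ
  have hgram : gram B' = Qᵀ * gram B * Q := by
    ext i j
    rw [Matrix.mul_apply]
    simp only [Matrix.mul_apply, Matrix.transpose_apply, Finset.sum_mul]
    rw [Finset.sum_comm]
    exact (hP _ _).trans ((apply_eq_sum_gram B _ _).trans <|
      Finset.sum_congr rfl fun i _ => Finset.sum_congr rfl fun j _ => mul_right_comm _ _ _)
  have hdet : IsUnit Q.det := by
    have hunit := hB'.isUnit_det_gram
    rw [hgram, Matrix.det_mul] at hunit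
    exact isUnit_of_mul_isUnit_right hunit
  have hinv : (gram B)⁻¹ = Q * (gram B')⁻¹ * Qᵀ := by
    rw [hgram, Matrix.mul_inv_rev, Matrix.mul_inv_rev, ← Matrix.mul_assoc,
      Matrix.mul_nonsing_inv _ hdet, Matrix.one_mul, Matrix.mul_assoc,
      Matrix.nonsing_inv_mul _ (Matrix.isUnit_det_transpose _ hdet), Matrix.mul_one]
  rw [hinv, Matrix.mul_apply]
  simp only [Matrix.mul_apply, Matrix.transpose_apply, Finset.sum_mul]
  rw [Finset.sum_comm]
  simp only [hQ, Matrix.of_apply, mul_comm (P (coordVec _) k)]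

theorem map_metricTrace {W W' : Type*} [AddCommGroup W] [Module ℝ W] [AddCommGroup W']
    [Module ℝ W'] (L : W →ₗ[ℝ] W') (G : Coord m → Coord m →L[ℝ] Coord m →L[ℝ] ℝ) (x : Coord m)
    (T : Coord m → Coord m → W) :
    L (metricTrace G x T) = metricTrace G x fun v w => L (T v w) := by
  simp only [metricTrace, map_sum, map_smul]

theorem metricTrace_comp_isometry {W : Type*} [NormedAddCommGroup W] [NormedSpace ℝ W]
    {G G' : Coord m → Coord m →L[ℝ] Coord m →L[ℝ] ℝ} {x y : Coord m}
    (hG' : IsInnerProduct (G' y)) (P : Coord m →L[ℝ] Coord m)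
    (hP : ∀ v w, G' y v w = G x (P v) (P w)) (T : Coord m →L[ℝ] Coord m →L[ℝ] W) :
    metricTrace G' y (fun v w => T (P v) (P w)) = metricTrace G x fun v w => T v w := by
  have hexpand (v w : Coord m) : T v w = ∑ k, ∑ l, (v k * w l) • T (coordVec k) (coordVec l) := by
    rw [apply_eq_sum_coordVec T v, sum_apply]
    refine Finset.sum_congr rfl fun k _ => ?_
    rw [smul_apply, apply_eq_sum_coordVec (T _) w, Finset.smul_sum]
    simp only [smul_smul]
  simp only [metricTrace, inverseMetric_eq, inv_gram_eq_sum_of_isometry hG' P hP,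
    hexpand (P _), Finset.smul_sum, Finset.sum_smul, smul_smul, ← mul_assoc]
  simpa only [Fintype.sum_prod_type] using Finset.sum_comm (s := Finset.univ) (t := Finset.univ)
    (f := fun p q : Fin m × Fin m => ((gram (G' y))⁻¹ p.1 p.2 * P (coordVec p.1) q.1
      * P (coordVec p.2) q.2) • T (coordVec q.1) (coordVec q.2))

end InnerProducts

section LeviCivita

variable {m n : ℕ}

/-- `G` is the coordinate expression of a Riemannian metric on the open set `U`. -/
structure IsMetricOn (G : Coord m → Coord m →L[ℝ] Coord m →L[ℝ] ℝ) (U : Set (Coord m)) :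
    Prop where
  isOpen : IsOpen U
  smooth : ContDiffOn ℝ ∞ G U
  isInnerProduct : ∀ x ∈ U, IsInnerProduct (G x)

variable {G : Coord m → Coord m →L[ℝ] Coord m →L[ℝ] ℝ} {U : Set (Coord m)}

theorem IsMetricOn.contDiffAt (hG : IsMetricOn G U) {x : Coord m} (hx : x ∈ U) :
    ContDiffAt ℝ ∞ G x :=
  hG.smooth.contDiffAt (hG.isOpen.mem_nhds hx)

theorem christoffel_eq_sharp (G : Coord m → Coord m →L[ℝ] Coord m →L[ℝ] ℝ) (x v w : Coord m) :
    christoffel G x v w = sharp (G x) fun l => (1 / 2 : ℝ) * (fderiv ℝ G x v w (coordVec l)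
      + fderiv ℝ G x w v (coordVec l) - fderiv ℝ G x (coordVec l) v w) := rfl

theorem gradient_eq_sharp (G : Coord m → Coord m →L[ℝ] Coord m →L[ℝ] ℝ) (f : Coord m → ℝ)
    (x : Coord m) : gradient G f x = sharp (G x) fun j => fderiv ℝ f x (coordVec j) := rfl

theorem IsMetricOn.apply_christoffel (hG : IsMetricOn G U) {x : Coord m} (hx : x ∈ U)
    (v w l : Coord m) : G x (christoffel G x v w) l
      = (1 / 2 : ℝ) * (fderiv ℝ G x v w l + fderiv ℝ G x w v l - fderiv ℝ G x l v w) := by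
  rw [christoffel_eq_sharp]
  exact (hG.isInnerProduct x hx).sharp_apply ((1 / 2 : ℝ) • (fderiv ℝ G x v w + fderiv ℝ G x w v
    - ((fderiv ℝ G x).flip v).flip w)) l

/-- The Christoffel map bundled as a continuous bilinear map, so that it can be differentiated as a
function of the base point. -/
def christoffelMap (G : Coord m → Coord m →L[ℝ] Coord m →L[ℝ] ℝ) (x : Coord m) :
    Coord m →L[ℝ] Coord m →L[ℝ] Coord m :=
  LinearMap.toContinuousLinearMap (LinearMap.toContinuousLinearMap.toLinearMap ∘ₗ
    LinearMap.mk₂ ℝ (christoffel G x)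
      (fun v v' w => by
        simp only [christoffel_eq_sharp, ← sharp_add]
        congr 1; funext l
        simp only [map_add, add_apply, Pi.add_apply]; ring)
      (fun c v w => by
        simp only [christoffel_eq_sharp, ← sharp_smul]
        congr 1; funext l
        simp only [map_smul, smul_apply, Pi.smul_apply, smul_eq_mul]; ring)
      (fun v w w' => by
        simp only [christoffel_eq_sharp, ← sharp_add]
        congr 1; funext l
        simp only [map_add, add_apply, Pi.add_apply]; ring)
      (fun c v w => by
        simp only [christoffel_eq_sharp, ← sharp_smul]
        congr 1; funext l
        simp only [map_smul, smul_apply, Pi.smul_apply, smul_eq_mul]; ring))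

theorem christoffelMap_apply (G : Coord m → Coord m →L[ℝ] Coord m →L[ℝ] ℝ) (x v w : Coord m) :
    christoffelMap G x v w = christoffel G x v w := rfl

theorem contDiffOn_det {E ι : Type*} [NormedAddCommGroup E] [NormedSpace ℝ E] [Fintype ι]
    [DecidableEq ι] {s : Set E} {A : E → Matrix ι ι ℝ}
    (hA : ∀ i j, ContDiffOn ℝ ∞ (fun x => A x i j) s) :
    ContDiffOn ℝ ∞ (fun x => (A x).det) s := by
  simp only [Matrix.det_apply]
  exact ContDiffOn.sum fun σ _ => (contDiffOn_prod fun i _ => hA _ _).const_smul _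

theorem contDiffOn_inv_apply {E ι : Type*} [NormedAddCommGroup E] [NormedSpace ℝ E] [Fintype ι]
    [DecidableEq ι] {s : Set E} {A : E → Matrix ι ι ℝ}
    (hA : ∀ i j, ContDiffOn ℝ ∞ (fun x => A x i j) s) (hdet : ∀ x ∈ s, (A x).det ≠ 0) (i j : ι) :
    ContDiffOn ℝ ∞ (fun x => (A x)⁻¹ i j) s := by
  have hadjugate : ContDiffOn ℝ ∞ (fun x => (A x).adjugate i j) s := by
    simp only [Matrix.adjugate_apply]
    refine contDiffOn_det fun k l => ?_
    simp only [Matrix.updateRow_apply]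
    split_ifs
    · exact contDiffOn_const
    · exact hA k l
  simp only [Matrix.inv_def, Matrix.smul_apply, Ring.inverse_eq_inv', smul_eq_mul]
  exact ((contDiffOn_det hA).inv hdet).mul hadjugate

theorem IsMetricOn.contDiffOn_inverseMetric (hG : IsMetricOn G U) (i j : Fin m) :
    ContDiffOn ℝ ∞ (fun x => inverseMetric G x i j) U :=
  contDiffOn_inv_apply
    (fun _ _ => (hG.smooth.clm_apply contDiffOn_const).clm_apply contDiffOn_const)
    (fun x hx => (hG.isInnerProduct x hx).isUnit_det_gram.ne_zero) i j

set_option maxSynthPendingDepth 3 in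
theorem IsMetricOn.contDiffOn_christoffelMap (hG : IsMetricOn G U) :
    ContDiffOn ℝ ∞ (christoffelMap G) U := by
  rw [contDiffOn_clm_apply]
  intro v
  rw [contDiffOn_clm_apply]
  intro w
  have hfderiv : ContDiffOn ℝ ∞ (fderiv ℝ G) U := hG.smooth.fderiv_of_isOpen hG.isOpen (by simp)
  have hfderiv_apply (a b c : Coord m) : ContDiffOn ℝ ∞ (fun x => fderiv ℝ G x a b c) U :=
    ((hfderiv.clm_apply contDiffOn_const).clm_apply contDiffOn_const).clm_apply contDiffOn_const
  simp only [christoffelMap_apply, christoffel]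
  exact ContDiffOn.sum fun k _ => ContDiffOn.fun_smul (ContDiffOn.sum fun l _ =>
    (hG.contDiffOn_inverseMetric k l).mul (contDiffOn_const.mul
      (((hfderiv_apply _ _ _).add (hfderiv_apply _ _ _)).sub (hfderiv_apply _ _ _))))
    contDiffOn_const

end LeviCivita

section SecondDerivatives

open Filter Topology

variable {E F F' : Type*} [NormedAddCommGroup E] [NormedSpace ℝ E] [NormedAddCommGroup F]
  [NormedSpace ℝ F] [NormedAddCommGroup F'] [NormedSpace ℝ F'] {φ : E → F} {θ : F → F'} {x : E}

theorem hasFDerivAt_fderiv_apply (hφ : ContDiffAt ℝ ∞ φ x) (w : E) :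
    HasFDerivAt (fun z => fderiv ℝ φ z w) ((fderiv ℝ (fderiv ℝ φ) x).flip w) x := by
  have hderiv : DifferentiableAt ℝ (fderiv ℝ φ) x :=
    (hφ.fderiv_right (m := ∞) (by simp)).differentiableAt (by simp)
  simpa using hderiv.hasFDerivAt.clm_apply (hasFDerivAt_const w x)

theorem fderiv_fderiv_comm (hφ : ContDiffAt ℝ ∞ φ x) (v w : E) :
    fderiv ℝ (fderiv ℝ φ) x v w = fderiv ℝ (fderiv ℝ φ) x w v :=
  (hφ.isSymmSndFDerivAt (by simpa using WithTop.coe_le_coe.2 (le_top (a := (2 : ℕ∞))))).eq v w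

theorem fderiv_fderiv_comp (hθ : ContDiffAt ℝ ∞ θ (φ x)) (hφ : ContDiffAt ℝ ∞ φ x) (v w : E) :
    fderiv ℝ (fderiv ℝ (θ ∘ φ)) x v w
      = fderiv ℝ (fderiv ℝ θ) (φ x) (fderiv ℝ φ x v) (fderiv ℝ φ x w)
        + fderiv ℝ θ (φ x) (fderiv ℝ (fderiv ℝ φ) x v w) := by
  have hfirst : (fun z => fderiv ℝ (θ ∘ φ) z w)
      =ᶠ[𝓝 x] fun z => fderiv ℝ θ (φ z) (fderiv ℝ φ z w) := by
    filter_upwards [hφ.continuousAt.eventually ((hθ.of_le (m := 1) (by simp)).eventually (by simp)),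
      (hφ.of_le (m := 1) (by simp)).eventually (by simp)] with y hθy hφy
    exact congrArg (· w)
      (fderiv_comp y (hθy.differentiableAt (by simp)) (hφy.differentiableAt (by simp)))
  have hθ' : HasFDerivAt (fderiv ℝ θ) (fderiv ℝ (fderiv ℝ θ) (φ x)) (φ x) :=
    ((hθ.fderiv_right (m := ∞) (by simp)).differentiableAt (by simp)).hasFDerivAt
  have hproduct := (hθ'.comp x (hφ.differentiableAt (by simp)).hasFDerivAt).clm_apply
    (hasFDerivAt_fderiv_apply hφ w)
  have hunique := (hasFDerivAt_fderiv_apply (hθ.comp x hφ) w).unique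
    (hproduct.congr_of_eventuallyEq hfirst)
  exact (congrArg (· v) hunique).trans (add_comm _ _)

end SecondDerivatives

section IsometricImmersions

open Filter Topology

variable {m n : ℕ} {G G' : Coord m → Coord m →L[ℝ] Coord m →L[ℝ] ℝ} {U U' : Set (Coord m)}
  {H H' : Coord n → Coord n →L[ℝ] Coord n →L[ℝ] ℝ} {O O' : Set (Coord n)}
  {φ φ' : Coord m → Coord n}

/-- The tangential part at `x`, bundled as a linear map. -/
def tangentPartMap (G : Coord m → Coord m →L[ℝ] Coord m →L[ℝ] ℝ)
    (H : Coord n → Coord n →L[ℝ] Coord n →L[ℝ] ℝ) (φ : Coord m → Coord n) (x : Coord m) :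
    Coord n →ₗ[ℝ] Coord m where
  toFun := tangentPart G H φ x
  map_add' W W' := by
    simp only [tangentPart, map_add, add_apply, mul_add, Finset.sum_add_distrib, add_smul]
  map_smul' c W := by
    simp only [tangentPart, map_smul, smul_apply, smul_eq_mul, mul_left_comm _ c, ← Finset.mul_sum,
      mul_smul, Finset.smul_sum, RingHom.id_apply]

theorem tangentPartMap_apply (G : Coord m → Coord m →L[ℝ] Coord m →L[ℝ] ℝ)
    (H : Coord n → Coord n →L[ℝ] Coord n →L[ℝ] ℝ) (φ : Coord m → Coord n) (x : Coord m)
    (W : Coord n) : tangentPartMap G H φ x W = tangentPart G H φ x W := rfl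

theorem covAlong_smul (H : Coord n → Coord n →L[ℝ] Coord n →L[ℝ] ℝ) (φ : Coord m → Coord n)
    {V : Coord m → Coord n} {x : Coord m} (hV : DifferentiableAt ℝ V x) (c : ℝ) (v : Coord m) :
    covAlong H φ (fun z => c • V z) x v = c • covAlong H φ V x v := by
  rw [covAlong, covAlong, fderiv_fun_const_smul hV, ← christoffelMap_apply, ← christoffelMap_apply,
    map_smul, smul_add, smul_apply]

theorem covAlong_congr (H : Coord n → Coord n →L[ℝ] Coord n →L[ℝ] ℝ) (φ : Coord m → Coord n)
    {V W : Coord m → Coord n} {x : Coord m} (h : V =ᶠ[𝓝 x] W) (v : Coord m) :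
    covAlong H φ V x v = covAlong H φ W x v := by
  rw [covAlong, covAlong, h.fderiv_eq, h.self_of_nhds]

theorem covAlong_fderiv {x : Coord m} (hφ : ContDiffAt ℝ ∞ φ x) (v w : Coord m) :
    covAlong H φ (fun z => fderiv ℝ φ z w) x v
      = fderiv ℝ (fderiv ℝ φ) x v w
        + christoffelMap H (φ x) (fderiv ℝ φ x v) (fderiv ℝ φ x w) := by
  rw [covAlong, (hasFDerivAt_fderiv_apply hφ w).fderiv]
  rfl

/-- The Hessian `∇dφ` of a map between Riemannian manifolds, as a continuous bilinear map. -/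
def hessian (G : Coord m → Coord m →L[ℝ] Coord m →L[ℝ] ℝ)
    (H : Coord n → Coord n →L[ℝ] Coord n →L[ℝ] ℝ) (φ : Coord m → Coord n) (x : Coord m) :
    Coord m →L[ℝ] Coord m →L[ℝ] Coord n :=
  fderiv ℝ (fderiv ℝ φ) x
    + (christoffelMap H (φ x)).bilinearComp (fderiv ℝ φ x) (fderiv ℝ φ x)
    - (ContinuousLinearMap.compL ℝ (Coord m) (Coord m) (Coord n) (fderiv ℝ φ x)).comp
        (christoffelMap G x)

theorem hessian_apply (x v w : Coord m) : hessian G H φ x v w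
    = fderiv ℝ (fderiv ℝ φ) x v w + christoffelMap H (φ x) (fderiv ℝ φ x v) (fderiv ℝ φ x w)
      - fderiv ℝ φ x (christoffelMap G x v w) := rfl

theorem tension_eq_metricTrace_hessian {x : Coord m} (hφ : ContDiffAt ℝ ∞ φ x) :
    tension G H φ x = metricTrace G x fun v w => hessian G H φ x v w := by
  simp only [tension, hessian_apply, covAlong_fderiv hφ, christoffelMap_apply]

theorem tension_congr {x : Coord m} (h : φ =ᶠ[𝓝 x] φ') (hφ : ContDiffAt ℝ ∞ φ x) :
    tension G H φ x = tension G H φ' x := by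
  rw [tension_eq_metricTrace_hessian hφ,
    tension_eq_metricTrace_hessian (hφ.congr_of_eventuallyEq h.symm)]
  simp only [hessian_apply, h.fderiv.fderiv_eq, h.fderiv_eq, h.eq_of_nhds]

theorem contDiffOn_tension (hG : IsMetricOn G U) (hH : IsMetricOn H O) (hmaps : Set.MapsTo φ U O)
    (hφ : ContDiffOn ℝ ∞ φ U) : ContDiffOn ℝ ∞ (tension G H φ) U := by
  have hDφ : ContDiffOn ℝ ∞ (fderiv ℝ φ) U := hφ.fderiv_of_isOpen hG.isOpen (by simp)
  have hD2φ : ContDiffOn ℝ ∞ (fderiv ℝ (fderiv ℝ φ)) U :=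
    hDφ.fderiv_of_isOpen hG.isOpen (by simp)
  have hΓ : ContDiffOn ℝ ∞ (fun x => christoffelMap H (φ x)) U :=
    hH.contDiffOn_christoffelMap.comp hφ hmaps
  have hDφ_apply (v : Coord m) : ContDiffOn ℝ ∞ (fun x => fderiv ℝ φ x v) U :=
    hDφ.clm_apply contDiffOn_const
  refine ContDiffOn.congr ?_ fun x hx =>
    tension_eq_metricTrace_hessian (hφ.contDiffAt (hG.isOpen.mem_nhds hx))
  simp only [metricTrace, hessian_apply]
  refine ContDiffOn.sum fun i _ => ContDiffOn.sum fun j _ =>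
    (hG.contDiffOn_inverseMetric i j).fun_smul (ContDiffOn.sub (ContDiffOn.add ?_ ?_) ?_)
  · exact (hD2φ.clm_apply contDiffOn_const).clm_apply contDiffOn_const
  · exact (hΓ.clm_apply (hDφ_apply _)).clm_apply (hDφ_apply _)
  · exact hDφ.clm_apply ((hG.contDiffOn_christoffelMap.clm_apply contDiffOn_const).clm_apply
      contDiffOn_const)

/-- `φ` is a smooth isometric immersion of the open set `U`, with metric `G`, into the open set `O`,
with metric `H`. -/
structure IsIsometricImmersionOn (G : Coord m → Coord m →L[ℝ] Coord m →L[ℝ] ℝ) (U : Set (Coord m))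
    (H : Coord n → Coord n →L[ℝ] Coord n →L[ℝ] ℝ) (O : Set (Coord n)) (φ : Coord m → Coord n) :
    Prop where
  source : IsMetricOn G U
  target : IsMetricOn H O
  mapsTo : Set.MapsTo φ U O
  smooth : ContDiffOn ℝ ∞ φ U
  isometric : ∀ x ∈ U, ∀ v w, H (φ x) (fderiv ℝ φ x v) (fderiv ℝ φ x w) = G x v w

namespace IsIsometricImmersionOn

theorem contDiffAt (h : IsIsometricImmersionOn G U H O φ) {x : Coord m} (hx : x ∈ U) :
    ContDiffAt ℝ ∞ φ x :=
  h.smooth.contDiffAt (h.source.isOpen.mem_nhds hx)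

theorem contDiffOn_tension (h : IsIsometricImmersionOn G U H O φ) :
    ContDiffOn ℝ ∞ (tension G H φ) U :=
  FBiharm.contDiffOn_tension h.source h.target h.mapsTo h.smooth

set_option maxSynthPendingDepth 3 in
theorem fderiv_metric (h : IsIsometricImmersionOn G U H O φ) {x : Coord m} (hx : x ∈ U)
    (v w l : Coord m) :
    fderiv ℝ G x v w l = fderiv ℝ H (φ x) (fderiv ℝ φ x v) (fderiv ℝ φ x w) (fderiv ℝ φ x l)
      + H (φ x) (fderiv ℝ (fderiv ℝ φ) x v w) (fderiv ℝ φ x l)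
      + H (φ x) (fderiv ℝ φ x w) (fderiv ℝ (fderiv ℝ φ) x v l) := by
  have hφ := h.contDiffAt hx
  have hdG : HasFDerivAt G (fderiv ℝ G x) x :=
    ((h.source.contDiffAt hx).differentiableAt (by simp)).hasFDerivAt
  have hdH : HasFDerivAt H (fderiv ℝ H (φ x)) (φ x) :=
    ((h.target.contDiffAt (h.mapsTo hx)).differentiableAt (by simp)).hasFDerivAt
  have hleft := (hdG.clm_apply (hasFDerivAt_const w x)).clm_apply (hasFDerivAt_const l x)
  have hright := ((hdH.comp x (hφ.differentiableAt (by simp)).hasFDerivAt).clm_apply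
    (hasFDerivAt_fderiv_apply hφ w)).clm_apply (hasFDerivAt_fderiv_apply hφ l)
  have hisometric :
      (fun z => G z w l) =ᶠ[𝓝 x] fun z => H (φ z) (fderiv ℝ φ z w) (fderiv ℝ φ z l) := by
    filter_upwards [h.source.isOpen.mem_nhds hx] with y hy
    rw [h.isometric y hy]
  have hderiv := congrArg (· v) (hleft.unique (hright.congr_of_eventuallyEq hisometric))
  simp only [ContinuousLinearMap.comp_zero, zero_add, ContinuousLinearMap.flip_apply, add_apply,
    ContinuousLinearMap.comp_apply, Function.comp_apply] at hderiv
  rw [hderiv]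
  ring

/-- The Levi-Civita connection of an immersed submanifold is the tangential part of the ambient
one. -/
theorem apply_christoffel (h : IsIsometricImmersionOn G U H O φ) {x : Coord m} (hx : x ∈ U)
    (v w l : Coord m) : G x (christoffel G x v w) l
      = H (φ x) (covAlong H φ (fun z => fderiv ℝ φ z w) x v) (fderiv ℝ φ x l) := by
  have hφ := h.contDiffAt hx
  have hH := h.target.isInnerProduct _ (h.mapsTo hx)
  rw [h.source.apply_christoffel hx, covAlong_fderiv hφ, map_add, add_apply, christoffelMap_apply,
    h.target.apply_christoffel (h.mapsTo hx), h.fderiv_metric hx, h.fderiv_metric hx,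
    h.fderiv_metric hx, fderiv_fderiv_comm hφ w v, fderiv_fderiv_comm hφ l v,
    fderiv_fderiv_comm hφ l w, hH.symm (fderiv ℝ φ x v) (fderiv ℝ (fderiv ℝ φ) x w l),
    hH.symm (fderiv ℝ φ x w) (fderiv ℝ (fderiv ℝ φ) x v l)]
  ring

theorem tangentPart_covAlong (h : IsIsometricImmersionOn G U H O φ) {x : Coord m} (hx : x ∈ U)
    (v w : Coord m) :
    tangentPart G H φ x (covAlong H φ (fun z => fderiv ℝ φ z w) x v) = christoffel G x v w :=
  (h.source.isInnerProduct x hx).sharp_eq fun j => h.apply_christoffel hx v w (coordVec j)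

theorem tangentPart_fderiv (h : IsIsometricImmersionOn G U H O φ) {x : Coord m} (hx : x ∈ U)
    (v : Coord m) : tangentPart G H φ x (fderiv ℝ φ x v) = v :=
  (h.source.isInnerProduct x hx).sharp_eq fun j => (h.isometric x hx v (coordVec j)).symm

theorem injective_fderiv (h : IsIsometricImmersionOn G U H O φ) {x : Coord m} (hx : x ∈ U) :
    Function.Injective (fderiv ℝ φ x) :=
  Function.LeftInverse.injective (h.tangentPart_fderiv hx)

theorem meanCurvature_eq (h : IsIsometricImmersionOn G U H O φ) {x : Coord m} (hx : x ∈ U) :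
    meanCurvature G H φ x = (1 / m : ℝ) • tension G H φ x := by
  simp only [meanCurvature, tension, secondFundForm, h.tangentPart_covAlong hx]

theorem meanCurvature_eq_zero_iff (h : IsIsometricImmersionOn G U H O φ) {x : Coord m}
    (hx : x ∈ U) : meanCurvature G H φ x = 0 ↔ tension G H φ x = 0 := by
  rw [h.meanCurvature_eq hx]
  rcases m.eq_zero_or_pos with rfl | hm
  · simp [tension, metricTrace]
  · simp [hm.ne']

theorem tangentPart_tension (h : IsIsometricImmersionOn G U H O φ) {x : Coord m} (hx : x ∈ U) :
    tangentPart G H φ x (tension G H φ x) = 0 := by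
  rw [← tangentPartMap_apply, tension, map_metricTrace]
  simp only [map_sub, tangentPartMap_apply, h.tangentPart_covAlong hx, h.tangentPart_fderiv hx,
    sub_self, metricTrace, smul_zero, Finset.sum_const_zero]

theorem tangentPart_covAlong_tension_gradient (h : IsIsometricImmersionOn G U H O φ) {x : Coord m}
    (hx : x ∈ U) (hbi : bitension G H φ x = 0) {f : Coord m → ℝ}
    (hf : fBitension G H φ f x = 0) :
    tangentPart G H φ x (covAlong H φ (tension G H φ) x (gradient G f x)) = 0 := by
  rw [fBitension, hbi, smul_zero, zero_add] at hf
  have htangent := congrArg (tangentPartMap G H φ x) hf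
  rwa [map_add, map_smul, map_smul, tangentPartMap_apply, tangentPartMap_apply,
    h.tangentPart_tension hx, smul_zero, zero_add, map_zero,
    smul_eq_zero_iff_right (two_ne_zero' ℝ)] at htangent

/-- The tangential part of `(Δf)τ + 2∇_{grad f}τ = 0` is `-2m |η|² grad f = 0`. -/
theorem fderiv_eq_zero_of_tension_ne_zero (h : IsIsometricImmersionOn G U H O φ) {x : Coord m}
    (hx : x ∈ U)
    (humb : ∀ v : Coord m, shapeOperator G H φ (meanCurvature G H φ) x v
      = H (φ x) (meanCurvature G H φ x) (meanCurvature G H φ x) • v)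
    (hbi : bitension G H φ x = 0) {f : Coord m → ℝ} (hf : fBitension G H φ f x = 0)
    (hτ : tension G H φ x ≠ 0) : fderiv ℝ f x = 0 := by
  have hη : meanCurvature G H φ =ᶠ[𝓝 x] fun z => (1 / m : ℝ) • tension G H φ z := by
    filter_upwards [h.source.isOpen.mem_nhds hx] with y hy
    exact h.meanCurvature_eq hy
  have hτ_diff : DifferentiableAt ℝ (tension G H φ) x :=
    (h.contDiffOn_tension.contDiffAt (h.source.isOpen.mem_nhds hx)).differentiableAt (by simp)
  have hη_pos : 0 < H (φ x) (meanCurvature G H φ x) (meanCurvature G H φ x) :=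
    (h.target.isInnerProduct _ (h.mapsTo hx)).pos _ (mt (h.meanCurvature_eq_zero_iff hx).1 hτ)
  have hgradient : gradient G f x = 0 := by
    have humb' := humb (gradient G f x)
    rwa [shapeOperator, covAlong_congr H φ hη, covAlong_smul H φ hτ_diff, ← tangentPartMap_apply,
      map_smul, tangentPartMap_apply, h.tangentPart_covAlong_tension_gradient hx hbi hf, smul_zero,
      neg_zero, eq_comm, smul_eq_zero_iff_right hη_pos.ne'] at humb'
  ext l
  rw [← (h.source.isInnerProduct x hx).sharp_apply (fderiv ℝ f x) l, ← gradient_eq_sharp, hgradient]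
  simp only [map_zero, zero_apply]

theorem fderiv_christoffel {ψ : Coord m → Coord m} (h : IsIsometricImmersionOn G' U' G U ψ)
    {x : Coord m} (hx : x ∈ U') (v w : Coord m) : fderiv ℝ ψ x (christoffelMap G' x v w)
      = fderiv ℝ (fderiv ℝ ψ) x v w
        + christoffelMap G (ψ x) (fderiv ℝ ψ x v) (fderiv ℝ ψ x w) := by
  rw [← covAlong_fderiv (h.contDiffAt hx)]
  refine (h.target.isInnerProduct _ (h.mapsTo hx)).ext_left fun l => ?_
  obtain ⟨l, rfl⟩ := (LinearMap.injective_iff_surjective (f := (fderiv ℝ ψ x).toLinearMap)).1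
    (h.injective_fderiv hx) l
  exact (h.isometric x hx _ l).trans (h.apply_christoffel hx v w l)

theorem hessian_comp_right {ψ : Coord m → Coord m} (hψ : IsIsometricImmersionOn G' U' G U ψ)
    {x : Coord m} (hx : x ∈ U') (hφ : ContDiffAt ℝ ∞ φ (ψ x)) (v w : Coord m) :
    hessian G' H (φ ∘ ψ) x v w = hessian G H φ (ψ x) (fderiv ℝ ψ x v) (fderiv ℝ ψ x w) := by
  have hψx := hψ.contDiffAt hx
  rw [hessian_apply, hessian_apply, fderiv_fderiv_comp hφ hψx,
    fderiv_comp x (hφ.differentiableAt (by simp)) (hψx.differentiableAt (by simp))]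
  simp only [ContinuousLinearMap.comp_apply, Function.comp_apply, hψ.fderiv_christoffel hx, map_add]
  abel

theorem hessian_comp_left {θ : Coord n → Coord n} (hθ : IsIsometricImmersionOn H' O' H O θ)
    {x : Coord m} (hφ : ContDiffAt ℝ ∞ φ x) (hx : φ x ∈ O') (v w : Coord m) :
    hessian G H (θ ∘ φ) x v w = fderiv ℝ θ (φ x) (hessian G H' φ x v w) := by
  have hθx := hθ.contDiffAt hx
  rw [hessian_apply, hessian_apply, fderiv_fderiv_comp hθx hφ,
    fderiv_comp x (hθx.differentiableAt (by simp)) (hφ.differentiableAt (by simp))]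
  simp only [ContinuousLinearMap.comp_apply, Function.comp_apply, map_sub, map_add,
    hθ.fderiv_christoffel hx]
  abel

theorem tension_comp_right {ψ : Coord m → Coord m} (hψ : IsIsometricImmersionOn G' U' G U ψ)
    {x : Coord m} (hx : x ∈ U') (hφ : ContDiffAt ℝ ∞ φ (ψ x)) :
    tension G' H (φ ∘ ψ) x = tension G H φ (ψ x) := by
  rw [tension_eq_metricTrace_hessian hφ,
    tension_eq_metricTrace_hessian (hφ.comp x (hψ.contDiffAt hx))]
  simp only [hψ.hessian_comp_right hx hφ]
  exact metricTrace_comp_isometry (hψ.source.isInnerProduct x hx) _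
    (fun v w => (hψ.isometric x hx v w).symm) _

theorem tension_comp_left {θ : Coord n → Coord n} (hθ : IsIsometricImmersionOn H' O' H O θ)
    {x : Coord m} (hφ : ContDiffAt ℝ ∞ φ x) (hx : φ x ∈ O') :
    tension G H (θ ∘ φ) x = fderiv ℝ θ (φ x) (tension G H' φ x) := by
  rw [tension_eq_metricTrace_hessian hφ,
    tension_eq_metricTrace_hessian ((hθ.contDiffAt hx).comp x hφ)]
  simp only [hθ.hessian_comp_left hφ hx]
  exact (map_metricTrace (fderiv ℝ θ (φ x)).toLinearMap _ _ _).symm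

end IsIsometricImmersionOn

end IsometricImmersions

section BiharmonicUniqueContinuation

open Asymptotics Filter Topology

variable {m n : ℕ} {G : Coord m → Coord m →L[ℝ] Coord m →L[ℝ] ℝ} {U K : Set (Coord m)}
  {H : Coord n → Coord n →L[ℝ] Coord n →L[ℝ] ℝ} {O : Set (Coord n)}
  {φ V : Coord m → Coord n}

theorem IsMetricOn.contDiffAt_christoffelMap (hG : IsMetricOn G U) {x : Coord m} (hx : x ∈ U) :
    ContDiffAt ℝ ∞ (christoffelMap G) x :=
  hG.contDiffOn_christoffelMap.contDiffAt (hG.isOpen.mem_nhds hx)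

theorem IsMetricOn.hasFDerivAt_christoffelMap (hG : IsMetricOn G U) {x : Coord m} (hx : x ∈ U) :
    HasFDerivAt (christoffelMap G) (fderiv ℝ (christoffelMap G) x) x :=
  ((hG.contDiffAt_christoffelMap hx).differentiableAt (by simp)).hasFDerivAt

theorem IsMetricOn.curvature_eq (hH : IsMetricOn H O) {y : Coord n} (hy : y ∈ O)
    (u v w : Coord n) :
    curvature H y u v w
      = (fderiv ℝ (christoffelMap H) y u v w + christoffelMap H y u (christoffelMap H y v w))
        - (fderiv ℝ (christoffelMap H) y v u w
          + christoffelMap H y v (christoffelMap H y u w)) := by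
  have hfderiv (a b c : Coord n) :
      fderiv ℝ (fun z => christoffel H z a b) y c = fderiv ℝ (christoffelMap H) y c a b := by
    have hcurried := ((hH.hasFDerivAt_christoffelMap hy).clm_apply
      (hasFDerivAt_const a y)).clm_apply (hasFDerivAt_const b y)
    simp only [christoffelMap_apply] at hcurried
    rw [hcurried.fderiv]
    simp
  rw [curvature, hfderiv, hfderiv]
  rfl

theorem IsMetricOn.covAlong_covAlong (hH : IsMetricOn H O) {x : Coord m} (hx : φ x ∈ O)
    (hφ : ContDiffAt ℝ ∞ φ x) (hV : ContDiffAt ℝ ∞ V x) (v w : Coord m) :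
    covAlong H φ (fun z => covAlong H φ V z w) x v
      = fderiv ℝ (fun z => fderiv ℝ V z w) x v
        + (christoffelMap H (φ x) (fderiv ℝ φ x w) (fderiv ℝ V x v)
          + christoffelMap H (φ x) (fderiv ℝ (fderiv ℝ φ) x v w) (V x)
          + fderiv ℝ (christoffelMap H) (φ x) (fderiv ℝ φ x v) (fderiv ℝ φ x w) (V x)
          + christoffelMap H (φ x) (fderiv ℝ φ x v) (fderiv ℝ V x w)
          + christoffelMap H (φ x) (fderiv ℝ φ x v)
            (christoffelMap H (φ x) (fderiv ℝ φ x w) (V x))) := by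
  have hasFDerivAt_V : HasFDerivAt V (fderiv ℝ V x) x :=
    (hV.differentiableAt (by simp)).hasFDerivAt
  have hasFDerivAt_φ : HasFDerivAt φ (fderiv ℝ φ x) x :=
    (hφ.differentiableAt (by simp)).hasFDerivAt
  have hasFDerivAt_covAlong := (hasFDerivAt_fderiv_apply hV w).add
    ((((hH.hasFDerivAt_christoffelMap hx).comp x hasFDerivAt_φ).clm_apply
      (hasFDerivAt_fderiv_apply hφ w)).clm_apply hasFDerivAt_V)
  have hfderiv : fderiv ℝ (fun z => covAlong H φ V z w) x = _ := hasFDerivAt_covAlong.fderiv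
  rw [covAlong, hfderiv, (hasFDerivAt_fderiv_apply hV w).fderiv, ← christoffelMap_apply]
  simp only [covAlong, ← christoffelMap_apply, map_add, ContinuousLinearMap.flip_apply, add_apply,
    ContinuousLinearMap.comp_apply, Function.comp_apply]
  abel

section BoundedCoefficients

variable {X E F : Type*} [TopologicalSpace X] [NormedAddCommGroup E] [NormedSpace ℝ E]
  [NormedAddCommGroup F] [NormedSpace ℝ F] {S : Set X} {L : X → E →L[ℝ] F} {f : X → E}
  {b : X → ℝ}

theorem isBigO_clm_apply_of_continuousOn_left (hS : IsCompact S) (hL : ContinuousOn L S)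
    (hf : f =O[𝓟 S] b) : (fun x => L x (f x)) =O[𝓟 S] b := by
  have hL_one : L =O[𝓟 S] fun _ => (1 : ℝ) := hL.isBigO_principal hS (by simp)
  simpa using isBoundedBilinearMap_apply.isBigO_comp.trans (hL_one.norm_left.mul hf.norm_left)

theorem isBigO_clm_apply_of_continuousOn_right (hS : IsCompact S) (hL : L =O[𝓟 S] b)
    (hf : ContinuousOn f S) : (fun x => L x (f x)) =O[𝓟 S] b := by
  have hf_one : f =O[𝓟 S] fun _ => (1 : ℝ) := hf.isBigO_principal hS (by simp)
  simpa using isBoundedBilinearMap_apply.isBigO_comp.trans (hL.norm_left.mul hf_one.norm_left)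

theorem isBigO_smul_of_continuousOn {c : X → ℝ} (hS : IsCompact S) (hc : ContinuousOn c S)
    (hf : f =O[𝓟 S] b) : (fun x => c x • f x) =O[𝓟 S] b := by
  have hc_one : c =O[𝓟 S] fun _ => (1 : ℝ) := hc.isBigO_principal hS (by simp)
  simpa using hc_one.smul hf

end BoundedCoefficients

/-- The size of the first jet of `V`, against which the lower order terms of the biharmonic system
are measured. -/
def jetNorm (V : Coord m → Coord n) (x : Coord m) : ℝ :=
  ‖V x‖ + ‖fderiv ℝ V x‖

theorem isBigO_jetNorm (V : Coord m → Coord n) (l : Filter (Coord m)) : V =O[l] jetNorm V :=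
  .of_norm_le fun _ => le_add_of_nonneg_right (norm_nonneg _)

theorem fderiv_isBigO_jetNorm (V : Coord m → Coord n) (l : Filter (Coord m)) :
    fderiv ℝ V =O[l] jetNorm V :=
  .of_norm_le fun _ => le_add_of_nonneg_left (norm_nonneg _)

theorem continuousOn_fderiv_of_contDiffAt {E F : Type*} [NormedAddCommGroup E] [NormedSpace ℝ E]
    [NormedAddCommGroup F] [NormedSpace ℝ F] {f : E → F} {S : Set E}
    (hf : ∀ x ∈ S, ContDiffAt ℝ ∞ f x) : ContinuousOn (fderiv ℝ f) S := fun x hx =>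
  ((hf x hx).fderiv_right (m := ∞) (by simp)).continuousAt.continuousWithinAt

theorem IsMetricOn.continuousOn_christoffelMap_comp (hH : IsMetricOn H O)
    (hφ : ContinuousOn φ K) (hmaps : Set.MapsTo φ K O) :
    ContinuousOn (fun x => christoffelMap H (φ x)) K :=
  hH.contDiffOn_christoffelMap.continuousOn.comp hφ hmaps

set_option maxSynthPendingDepth 3 in
theorem IsMetricOn.continuousOn_fderiv_christoffelMap_comp (hH : IsMetricOn H O)
    (hφ : ContinuousOn φ K) (hmaps : Set.MapsTo φ K O) :
    ContinuousOn (fun x => fderiv ℝ (christoffelMap H) (φ x)) K :=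
  (continuousOn_fderiv_of_contDiffAt fun _ => hH.contDiffAt_christoffelMap).comp hφ hmaps

theorem IsMetricOn.covAlong_isBigO_jetNorm (hH : IsMetricOn H O) (hK : IsCompact K)
    (hmaps : Set.MapsTo φ K O) (hφ : ∀ x ∈ K, ContDiffAt ℝ ∞ φ x) {X : Coord m → Coord m}
    (hX : ContinuousOn X K) : (fun x => covAlong H φ V x (X x)) =O[𝓟 K] jetNorm V := by
  have hφ_cont : ContinuousOn φ K := fun x hx => (hφ x hx).continuousAt.continuousWithinAt
  have hΓ := hH.continuousOn_christoffelMap_comp hφ_cont hmaps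
  have hDφ := continuousOn_fderiv_of_contDiffAt hφ
  exact (isBigO_clm_apply_of_continuousOn_right hK (fderiv_isBigO_jetNorm V _) hX).add
    (isBigO_clm_apply_of_continuousOn_left hK (hΓ.clm_apply (hDφ.clm_apply hX))
      (isBigO_jetNorm V _))

set_option maxSynthPendingDepth 3 in
theorem IsMetricOn.covAlong_covAlong_sub_isBigO_jetNorm (hH : IsMetricOn H O) (hK : IsCompact K)
    (hmaps : Set.MapsTo φ K O) (hφ : ∀ x ∈ K, ContDiffAt ℝ ∞ φ x)
    (hV : ∀ x ∈ K, ContDiffAt ℝ ∞ V x) (v w : Coord m) :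
    (fun x => covAlong H φ (fun z => covAlong H φ V z w) x v
      - fderiv ℝ (fun z => fderiv ℝ V z w) x v) =O[𝓟 K] jetNorm V := by
  have hφ_cont : ContinuousOn φ K := fun x hx => (hφ x hx).continuousAt.continuousWithinAt
  have hΓ := hH.continuousOn_christoffelMap_comp hφ_cont hmaps
  have hDΓ := hH.continuousOn_fderiv_christoffelMap_comp hφ_cont hmaps
  have hDφ (u : Coord m) : ContinuousOn (fun x => fderiv ℝ φ x u) K :=
    (continuousOn_fderiv_of_contDiffAt hφ).clm_apply continuousOn_const
  have hD2φ : ContinuousOn (fun x => fderiv ℝ (fderiv ℝ φ) x v w) K :=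
    ((continuousOn_fderiv_of_contDiffAt fun x hx => (hφ x hx).fderiv_right (by simp)).clm_apply
      continuousOn_const).clm_apply continuousOn_const
  have hV_bound := isBigO_jetNorm V (𝓟 K)
  have hDV_bound (u : Coord m) : (fun x => fderiv ℝ V x u) =O[𝓟 K] jetNorm V :=
    isBigO_clm_apply_of_continuousOn_right hK (fderiv_isBigO_jetNorm V _) continuousOn_const
  have hΓV_bound (u : Coord m) {W : Coord m → Coord n} (hW : W =O[𝓟 K] jetNorm V) :
      (fun x => christoffelMap H (φ x) (fderiv ℝ φ x u) (W x)) =O[𝓟 K] jetNorm V :=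
    isBigO_clm_apply_of_continuousOn_left hK (hΓ.clm_apply (hDφ u)) hW
  refine IsBigO.congr' (((((hΓV_bound w (hDV_bound v)).add
    (isBigO_clm_apply_of_continuousOn_left hK (hΓ.clm_apply hD2φ) hV_bound)).add
    (isBigO_clm_apply_of_continuousOn_left hK ((hDΓ.clm_apply (hDφ v)).clm_apply (hDφ w))
      hV_bound)).add (hΓV_bound v (hDV_bound w))).add (hΓV_bound v (hΓV_bound w hV_bound)))
    (eventually_principal.2 fun x hx => ?_) .rfl
  beta_reduce
  rw [hH.covAlong_covAlong (hmaps hx) (hφ x hx) (hV x hx), add_sub_cancel_left]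

set_option maxSynthPendingDepth 3 in
theorem IsMetricOn.curvature_isBigO (hH : IsMetricOn H O) (hK : IsCompact K)
    (hmaps : Set.MapsTo φ K O) (hφ : ContinuousOn φ K) {X Y : Coord m → Coord n}
    (hX : ContinuousOn X K) (hY : ContinuousOn Y K) {b : Coord m → ℝ} (hV : V =O[𝓟 K] b) :
    (fun x => curvature H (φ x) (X x) (V x) (Y x)) =O[𝓟 K] b := by
  have hΓ := hH.continuousOn_christoffelMap_comp hφ hmaps
  have hDΓ := hH.continuousOn_fderiv_christoffelMap_comp hφ hmaps
  have hΓV := isBigO_clm_apply_of_continuousOn_left hK hΓ hV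
  refine IsBigO.congr' (IsBigO.sub
    (IsBigO.add (isBigO_clm_apply_of_continuousOn_right hK
        (isBigO_clm_apply_of_continuousOn_left hK (hDΓ.clm_apply hX) hV) hY)
      (isBigO_clm_apply_of_continuousOn_left hK (hΓ.clm_apply hX)
        (isBigO_clm_apply_of_continuousOn_right hK hΓV hY)))
    (IsBigO.add (isBigO_clm_apply_of_continuousOn_right hK
        (isBigO_clm_apply_of_continuousOn_right hK
          (isBigO_clm_apply_of_continuousOn_left hK hDΓ hV) hX) hY)
      (isBigO_clm_apply_of_continuousOn_right hK hΓV ((hΓ.clm_apply hX).clm_apply hY))))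
    (eventually_principal.2 fun x hx => ?_) .rfl
  exact (hH.curvature_eq (hmaps hx) _ _ _).symm

theorem metricTrace_isBigO (hG : IsMetricOn G U) (hK : IsCompact K) (hKU : K ⊆ U)
    {T : Coord m → Coord m → Coord m → Coord n} {b : Coord m → ℝ}
    (hT : ∀ v w, (fun x => T x v w) =O[𝓟 K] b) :
    (fun x => metricTrace G x (T x)) =O[𝓟 K] b :=
  IsBigO.fun_sum fun i _ => IsBigO.fun_sum fun j _ => isBigO_smul_of_continuousOn hK
    ((hG.contDiffOn_inverseMetric i j).continuousOn.mono hKU) (hT _ _)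

theorem roughLaplacian_sub_principalPart_isBigO (hG : IsMetricOn G U) (hH : IsMetricOn H O)
    (hK : IsCompact K) (hKU : K ⊆ U) (hmaps : Set.MapsTo φ K O)
    (hφ : ∀ x ∈ K, ContDiffAt ℝ ∞ φ x) (hV : ∀ x ∈ K, ContDiffAt ℝ ∞ V x) :
    (fun x => roughLaplacian G H φ V x - principalPart (fun i j z => inverseMetric G z i j) V x)
      =O[𝓟 K] jetNorm V := by
  have hΓ (v w : Coord m) : ContinuousOn (fun x => christoffel G x v w) K :=
    ((hG.contDiffOn_christoffelMap.continuousOn.mono hKU).clm_apply continuousOn_const).clm_apply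
      continuousOn_const
  refine (metricTrace_isBigO hG hK hKU fun v w =>
    (hH.covAlong_covAlong_sub_isBigO_jetNorm hK hmaps hφ hV v w).sub
      (hH.covAlong_isBigO_jetNorm hK hmaps hφ (hΓ v w))).congr_left fun x => ?_
  simp only [roughLaplacian, principalPart, metricTrace, ← Finset.sum_sub_distrib, ← smul_sub]
  simp only [sub_right_comm]

namespace IsIsometricImmersionOn

theorem principalPart_tension_isBigO (h : IsIsometricImmersionOn G U H O φ)
    (hbi : ∀ x ∈ U, bitension G H φ x = 0) (hK : IsCompact K) (hKU : K ⊆ U) :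
    principalPart (fun i j x => inverseMetric G x i j) (tension G H φ)
      =O[𝓟 K] jetNorm (tension G H φ) := by
  have hmaps : Set.MapsTo φ K O := h.mapsTo.mono_left hKU
  have hφ : ∀ x ∈ K, ContDiffAt ℝ ∞ φ x := fun x hx => h.contDiffAt (hKU hx)
  have hτ : ∀ x ∈ K, ContDiffAt ℝ ∞ (tension G H φ) x := fun x hx =>
    h.contDiffOn_tension.contDiffAt (h.source.isOpen.mem_nhds (hKU hx))
  have hDφ (v : Coord m) : ContinuousOn (fun x => fderiv ℝ φ x v) K :=
    (continuousOn_fderiv_of_contDiffAt hφ).clm_apply continuousOn_const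
  have hcurvature := metricTrace_isBigO h.source hK hKU fun v w =>
    h.target.curvature_isBigO hK hmaps (h.smooth.continuousOn.mono hKU) (hDφ v) (hDφ w)
      (isBigO_jetNorm (tension G H φ) _)
  refine (hcurvature.sub
    (roughLaplacian_sub_principalPart_isBigO h.source h.target hK hKU hmaps hφ hτ)).congr'
    (eventually_principal.2 fun x hx => ?_) .rfl
  have hbi_x := sub_eq_zero.1 (hbi x (hKU hx))
  beta_reduce
  rw [← hbi_x, sub_sub_cancel]

theorem eqOn_tension_zero_ball (h : IsIsometricImmersionOn G U H O φ)
    (hbi : ∀ x ∈ U, bitension G H φ x = 0) {q : Coord m} {r ρ R : ℝ} (hr : 0 < r) (hρ : 0 < ρ)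
    (hR : ρ < R) (hball : Metric.closedBall q R ⊆ U)
    (hzero : Set.EqOn (tension G H φ) 0 (Metric.ball q r)) :
    Set.EqOn (tension G H φ) 0 (Metric.ball q ρ) := by
  obtain ⟨C, hC⟩ := isBigO_principal.1
    (h.principalPart_tension_isBigO hbi (isCompact_closedBall q R) hball)
  obtain ⟨R', hρR', hR'R⟩ := exists_between hR
  refine eqOn_zero_ball_of_norm_principalPart_le h.source.isOpen h.source.contDiffOn_inverseMetric
    (fun i j x hx => (h.source.isInnerProduct x hx).inv_gram_symm i j)
    (fun x hx ξ hξ => (h.source.isInnerProduct x hx).inv_gram_pos hξ) h.contDiffOn_tension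
    hr hρ hρR' hR'R hball (C := C) (fun x hx => ?_) hzero
  simpa [jetNorm, abs_of_nonneg (add_nonneg (norm_nonneg _) (norm_nonneg _))]
    using hC x (Metric.ball_subset_closedBall (Metric.ball_subset_ball hR.le hx))

/-- Unique continuation across the boundary of the zero set: a ball centred at a nearby point of
the zero set can be enlarged until it contains `p`. -/
theorem eventuallyEq_tension_zero_of_mem_closure (h : IsIsometricImmersionOn G U H O φ)
    (hbi : ∀ x ∈ U, bitension G H φ x = 0) {p : Coord m} (hp : p ∈ U)
    (hclosure : p ∈ closure {x | tension G H φ =ᶠ[𝓝 x] 0}) : tension G H φ =ᶠ[𝓝 p] 0 := by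
  obtain ⟨ε, hε, hεU⟩ := Metric.isOpen_iff.1 h.source.isOpen p hp
  obtain ⟨q, hq, hpq⟩ := Metric.mem_closure_iff.1 hclosure (ε / 4) (by positivity)
  obtain ⟨r, hr, hzero⟩ := Metric.eventually_nhds_iff_ball.1 hq
  have hball : Metric.closedBall q (5 * ε / 8) ⊆ U := by
    refine .trans (fun x hx => ?_) hεU
    rw [Metric.mem_closedBall] at hx
    rw [Metric.mem_ball]
    linarith [dist_triangle x q p, dist_comm p q]
  have hp_mem : p ∈ Metric.ball q (ε / 2) := by
    rw [Metric.mem_ball]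
    linarith
  have hzero_ball := h.eqOn_tension_zero_ball hbi hr (half_pos hε) (by linarith) hball hzero
  exact hzero_ball.eventuallyEq_of_mem (Metric.isOpen_ball.mem_nhds hp_mem)

end IsIsometricImmersionOn

end BiharmonicUniqueContinuation

/-! ### Passage to manifolds -/

section Charts

open Filter Topology Bundle

variable {m n : ℕ} {M N : Type*} [TopologicalSpace M] [TopologicalSpace N]
  {c : OpenPartialHomeomorph M (Coord m)} {d : OpenPartialHomeomorph N (Coord n)} {φ : M → N}

/-- The domain of the coordinate expression of `φ` in the charts `c` and `d`. -/
def chartDomain (φ : M → N) (c : OpenPartialHomeomorph M (Coord m))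
    (d : OpenPartialHomeomorph N (Coord n)) : Set (Coord m) :=
  c.target ∩ c.symm ⁻¹' (φ ⁻¹' d.source)

theorem map_mem_chartDomain {p : M} (hpc : p ∈ c.source) (hpd : φ p ∈ d.source) :
    c p ∈ chartDomain φ c d :=
  ⟨c.map_source hpc, by simpa [c.left_inv hpc] using hpd⟩

theorem isOpen_chartDomain (hφ : Continuous φ) : IsOpen (chartDomain φ c d) :=
  c.symm.isOpen_inter_preimage (d.open_source.preimage hφ)

variable [ChartedSpace (Coord m) M] [ChartedSpace (Coord n) N]

theorem contDiffOn_inCharts (hφ : ContMDiff (𝓡 m) (𝓡 n) ∞ φ)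
    (hc : c ∈ IsManifold.maximalAtlas (𝓡 m) ∞ M) (hd : d ∈ IsManifold.maximalAtlas (𝓡 n) ∞ N) :
    ContDiffOn ℝ ∞ (fun z => d (φ (c.symm z))) (chartDomain φ c d) :=
  contMDiffOn_iff_contDiffOn.1 <| (contMDiffOn_of_mem_maximalAtlas hd).comp
    (hφ.comp_contMDiffOn
      ((contMDiffOn_symm_of_mem_maximalAtlas hc).mono Set.inter_subset_left)) fun _ hx => hx.2

theorem mdifferentiable_of_mem_maximalAtlas (hc : c ∈ IsManifold.maximalAtlas (𝓡 m) ∞ M) :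
    c.MDifferentiable (𝓡 m) (𝓡 m) :=
  ⟨(contMDiffOn_of_mem_maximalAtlas hc).mdifferentiableOn (by simp),
    (contMDiffOn_symm_of_mem_maximalAtlas hc).mdifferentiableOn (by simp)⟩

theorem mfderiv_symm_fderiv_inCharts (hφ : ContMDiff (𝓡 m) (𝓡 n) ∞ φ)
    (hc : c ∈ IsManifold.maximalAtlas (𝓡 m) ∞ M) (hd : d ∈ IsManifold.maximalAtlas (𝓡 n) ∞ N)
    {x : Coord m} (hx : x ∈ chartDomain φ c d) (v : Coord m) :
    mfderiv (𝓡 n) (𝓡 n) d.symm (d (φ (c.symm x))) (fderiv ℝ (fun z => d (φ (c.symm z))) x v)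
      = mfderiv (𝓡 m) (𝓡 n) φ (c.symm x) (mfderiv (𝓡 m) (𝓡 m) c.symm x v) := by
  have hdomain := (isOpen_chartDomain hφ.continuous).mem_nhds hx
  have hφ' : HasMFDerivAt (𝓡 m) (𝓡 n) (fun z => d (φ (c.symm z))) x
      (fderiv ℝ (fun z => d (φ (c.symm z))) x) :=
    (((contDiffOn_inCharts hφ hc hd).contDiffAt hdomain).differentiableAt
      (by simp)).hasFDerivAt.hasMFDerivAt
  have hleft := ((mdifferentiable_of_mem_maximalAtlas hd).symm.mdifferentiableAt
    (d.map_source hx.2)).hasMFDerivAt.comp x hφ'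
  have hright := ((hφ.contMDiffAt (x := c.symm x)).mdifferentiableAt (by simp)).hasMFDerivAt.comp x
    ((mdifferentiable_of_mem_maximalAtlas hc).mdifferentiableAt_symm hx.1).hasMFDerivAt
  have heq : φ ∘ c.symm =ᶠ[𝓝 x] d.symm ∘ fun z => d (φ (c.symm z)) := by
    filter_upwards [hdomain] with y hy
    exact (d.left_inv hy.2).symm
  exact congrArg (fun L => L v) (hasMFDerivAt_unique (hleft.congr_of_eventuallyEq heq) hright)

variable [IsManifold (𝓡 m) ∞ M] [IsManifold (𝓡 n) ∞ N] {g : RMetric m M} {h : RMetric n N}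

theorem contMDiffOn_mfderiv_symm (hc : c ∈ IsManifold.maximalAtlas (𝓡 m) ∞ M) (v : Coord m) :
    ContMDiffOn (𝓡 m) (𝓡 m).tangent ∞
      (fun x => (TotalSpace.mk' (Coord m) (E := (TangentSpace (𝓡 m) : M → Type _)) (c.symm x)
        (mfderiv (𝓡 m) (𝓡 m) c.symm x v))) c.target := by
  have htangentMap := (contMDiffOn_symm_of_mem_maximalAtlas hc).contMDiffOn_tangentMapWithin
    (m := ∞) (by simp) c.open_target.uniqueMDiffOn
  have hconst : ContMDiffOn (𝓡 m) (𝓡 m).tangent ∞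
      (fun x : Coord m => (TotalSpace.mk' (Coord m)
        (E := (TangentSpace (𝓡 m) : Coord m → Type _)) x v)) c.target :=
    contMDiffOn_vectorSpace_iff_contDiffOn.2 contDiffOn_const
  refine (htangentMap.comp hconst fun x hx => hx).congr fun x hx => ?_
  simp only [Function.comp_apply, tangentMapWithin]
  rw [mfderivWithin_of_isOpen c.open_target hx]

theorem contMDiffOn_inner_mfderiv_symm (g : RMetric m M)
    (hc : c ∈ IsManifold.maximalAtlas (𝓡 m) ∞ M) (v w : Coord m) :
    ContMDiffOn (𝓡 m) 𝓘(ℝ, ℝ) ∞ (fun x => g.inner (c.symm x)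
      (mfderiv (𝓡 m) (𝓡 m) c.symm x v) (mfderiv (𝓡 m) (𝓡 m) c.symm x w)) c.target := by
  intro x hx
  have hmetric := ContMDiffAt.comp_contMDiffWithinAt x (g.contMDiff.contMDiffAt (x := c.symm x))
    (contMDiffOn_symm_of_mem_maximalAtlas hc x hx)
  have hinner := ContMDiffWithinAt.clm_bundle_apply₂ (F₁ := Coord m) (F₂ := Coord m) (F₃ := ℝ)
    (E₃ := Bundle.Trivial M ℝ) (ψ := fun x => g.inner (c.symm x)) hmetric
    (contMDiffOn_mfderiv_symm hc v x hx) (contMDiffOn_mfderiv_symm hc w x hx)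
  rw [contMDiffWithinAt_totalSpace] at hinner
  exact hinner.2

theorem isMetricOn_metricInChart (g : RMetric m M)
    (hc : c ∈ IsManifold.maximalAtlas (𝓡 m) ∞ M) : IsMetricOn (metricInChart g c) c.target where
  isOpen := c.open_target
  smooth := by
    simp only [contDiffOn_clm_apply]
    exact fun v w => contMDiffOn_iff_contDiffOn.1 (contMDiffOn_inner_mfderiv_symm g hc v w)
  isInnerProduct x hx :=
    { symm := fun v w => by
        rw [metricInChart_apply, metricInChart_apply]
        exact g.symm _ _ _
      pos := fun v hv => by
        rw [metricInChart_apply]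
        refine g.pos _ _ fun hzero => hv ?_
        exact (mdifferentiable_of_mem_maximalAtlas hc).symm.mfderiv_injective hx
          (hzero.trans (map_zero _).symm) }

theorem isIsometricImmersion_id (g : RMetric m M) : IsIsometricImmersion g g id where
  smooth := contMDiff_id
  isometric p v w := by rw [mfderiv_id]; rfl

theorem IsIsometricImmersion.isIsometricImmersionOn (hφ : IsIsometricImmersion g h φ)
    (hc : c ∈ IsManifold.maximalAtlas (𝓡 m) ∞ M) (hd : d ∈ IsManifold.maximalAtlas (𝓡 n) ∞ N) :
    IsIsometricImmersionOn (metricInChart g c) (chartDomain φ c d) (metricInChart h d) d.target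
      (fun z => d (φ (c.symm z))) where
  source :=
    have hG := isMetricOn_metricInChart g hc
    ⟨isOpen_chartDomain hφ.smooth.continuous, hG.smooth.mono Set.inter_subset_left,
      fun x hx => hG.isInnerProduct x hx.1⟩
  target := isMetricOn_metricInChart h hd
  mapsTo _ hx := d.map_source hx.2
  smooth := contDiffOn_inCharts hφ.smooth hc hd
  isometric x hx v w := by
    have hinner {p q : N} (hpq : p = q) (a b : Coord n) :
        (h.inner p : Coord n →L[ℝ] Coord n →L[ℝ] ℝ) a b
          = (h.inner q : Coord n →L[ℝ] Coord n →L[ℝ] ℝ) a b := by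
      rw [hpq]
    rw [metricInChart_apply, metricInChart_apply, ← hφ.isometric (c.symm x)]
    refine (hinner (d.left_inv hx.2) _ _).trans ?_
    exact congrArg₂ (fun a b : Coord n =>
      (h.inner (φ (c.symm x)) : Coord n →L[ℝ] Coord n →L[ℝ] ℝ) a b)
      (mfderiv_symm_fderiv_inCharts hφ.smooth hc hd hx v)
      (mfderiv_symm_fderiv_inCharts hφ.smooth hc hd hx w)

end Charts

section Manifolds

open Filter Topology

variable {m n : ℕ}
  {M : Type*} [TopologicalSpace M] [ChartedSpace (Coord m) M] [IsManifold (𝓡 m) ∞ M]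
  {N : Type*} [TopologicalSpace N] [ChartedSpace (Coord n) N] [IsManifold (𝓡 n) ∞ N]
  {g : RMetric m M} {h : RMetric n N} {φ : M → N}
  {c c' : OpenPartialHomeomorph M (Coord m)} {d d' : OpenPartialHomeomorph N (Coord n)}

/-- The tension field of `φ`, expressed in charts `c` of `M` and `d` of `N`. -/
def tensionInCharts (g : RMetric m M) (h : RMetric n N) (φ : M → N)
    (c : OpenPartialHomeomorph M (Coord m)) (d : OpenPartialHomeomorph N (Coord n)) :
    Coord m → Coord n :=
  tension (metricInChart g c) (metricInChart h d) fun z => d (φ (c.symm z))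

namespace IsIsometricImmersion

theorem tensionInCharts_change (hφ : IsIsometricImmersion g h φ)
    (hc : c ∈ IsManifold.maximalAtlas (𝓡 m) ∞ M) (hc' : c' ∈ IsManifold.maximalAtlas (𝓡 m) ∞ M)
    (hd : d ∈ IsManifold.maximalAtlas (𝓡 n) ∞ N) (hd' : d' ∈ IsManifold.maximalAtlas (𝓡 n) ∞ N)
    {p : M} (hpc : p ∈ c.source) (hpc' : p ∈ c'.source) (hpd : φ p ∈ d.source)
    (hpd' : φ p ∈ d'.source) :
    tensionInCharts g h φ c d (c p)
      = fderiv ℝ (fun y => d (id (d'.symm y))) (d' (φ p)) (tensionInCharts g h φ c' d' (c' p)) := by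
  set ψ : Coord m → Coord m := fun z => c (id (c'.symm z))
  set θ : Coord n → Coord n := fun y => d (id (d'.symm y))
  set φc : Coord m → Coord n := fun z => d (φ (c.symm z))
  set φc' : Coord m → Coord n := fun z => d' (φ (c'.symm z))
  have hψ := (isIsometricImmersion_id g).isIsometricImmersionOn hc' hc
  have hθ := (isIsometricImmersion_id h).isIsometricImmersionOn hd' hd
  have hψ_mem : c' p ∈ chartDomain id c' c := map_mem_chartDomain hpc' hpc
  have hφc'_mem : c' p ∈ chartDomain φ c' d' := map_mem_chartDomain hpc' hpd'
  have hψ_map : ψ (c' p) = c p := congrArg c (c'.left_inv hpc')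
  have hφc'_map : φc' (c' p) = d' (φ p) := congrArg (d' ∘ φ) (c'.left_inv hpc')
  have hθ_mem : φc' (c' p) ∈ chartDomain id d' d := hφc'_map ▸ map_mem_chartDomain hpd' hpd
  have hφc : ContDiffAt ℝ ∞ φc (ψ (c' p)) :=
    hψ_map ▸ (hφ.isIsometricImmersionOn hc hd).contDiffAt (map_mem_chartDomain hpc hpd)
  have hφc' : ContDiffAt ℝ ∞ φc' (c' p) :=
    (hφ.isIsometricImmersionOn hc' hd').contDiffAt hφc'_mem
  have heq : φc ∘ ψ =ᶠ[𝓝 (c' p)] θ ∘ φc' := by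
    filter_upwards [(isOpen_chartDomain continuous_id).mem_nhds hψ_mem,
      (isOpen_chartDomain hφ.smooth.continuous).mem_nhds hφc'_mem] with z hz hz'
    have hz_source : c'.symm z ∈ c.source := hz.2
    simp only [Function.comp_apply, φc, φc', ψ, θ, id, c.left_inv hz_source, d'.left_inv hz'.2]
  rw [tensionInCharts, tensionInCharts, ← hψ_map, ← hφc'_map, ← hψ.tension_comp_right hψ_mem hφc,
    tension_congr heq (hφc.comp _ (hψ.contDiffAt hψ_mem)), hθ.tension_comp_left hφc' hθ_mem]

end IsIsometricImmersion

/-- The set of points at which the tension field vanishes. The condition does not depend on the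
charts, by `IsIsometricImmersion.mem_tensionZeroSet_iff`. -/
def tensionZeroSet (g : RMetric m M) (h : RMetric n N) (φ : M → N) : Set M :=
  {p | tensionInCharts g h φ (chartAt (Coord m) p) (chartAt (Coord n) (φ p))
    (chartAt (Coord m) p p) = 0}

namespace IsIsometricImmersion

theorem mem_tensionZeroSet_iff (hφ : IsIsometricImmersion g h φ)
    (hc : c ∈ IsManifold.maximalAtlas (𝓡 m) ∞ M) (hd : d ∈ IsManifold.maximalAtlas (𝓡 n) ∞ N)
    {p : M} (hpc : p ∈ c.source) (hpd : φ p ∈ d.source) :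
    p ∈ tensionZeroSet g h φ ↔ tensionInCharts g h φ c d (c p) = 0 := by
  have hd₀ := IsManifold.chart_mem_maximalAtlas (I := 𝓡 n) (n := ∞) (φ p)
  have hθ := (isIsometricImmersion_id h).isIsometricImmersionOn hd₀ hd
  rw [hφ.tensionInCharts_change hc (IsManifold.chart_mem_maximalAtlas p) hd hd₀ hpc
      (mem_chart_source _ p) hpd (mem_chart_source _ (φ p)),
    map_eq_zero_iff _ (hθ.injective_fderiv (map_mem_chartDomain (mem_chart_source _ (φ p)) hpd))]
  rfl

theorem mem_interior_tensionZeroSet_iff (hφ : IsIsometricImmersion g h φ)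
    (hc : c ∈ IsManifold.maximalAtlas (𝓡 m) ∞ M) (hd : d ∈ IsManifold.maximalAtlas (𝓡 n) ∞ N)
    {p : M} (hpc : p ∈ c.source) (hpd : φ p ∈ d.source) :
    p ∈ interior (tensionZeroSet g h φ) ↔ tensionInCharts g h φ c d =ᶠ[𝓝 (c p)] 0 := by
  have hmem : ∀ᶠ q in 𝓝 p, q ∈ tensionZeroSet g h φ ↔ tensionInCharts g h φ c d (c q) = 0 := by
    filter_upwards [c.open_source.mem_nhds hpc,
      (d.open_source.preimage hφ.smooth.continuous).mem_nhds hpd] with q hqc hqd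
    exact hφ.mem_tensionZeroSet_iff hc hd hqc hqd
  rw [mem_interior_iff_mem_nhds, EventuallyEq, ← c.map_nhds_eq hpc, eventually_map]
  exact eventually_congr hmem

theorem isClopen_interior_tensionZeroSet (hφ : IsIsometricImmersion g h φ)
    (hbi : IsBiharmonic g h φ) : IsClopen (interior (tensionZeroSet g h φ)) := by
  refine ⟨isClosed_of_closure_subset fun p hp => ?_, isOpen_interior⟩
  set c := chartAt (Coord m) p
  set d := chartAt (Coord n) (φ p)
  have hc : c ∈ IsManifold.maximalAtlas (𝓡 m) ∞ M := IsManifold.chart_mem_maximalAtlas p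
  have hd : d ∈ IsManifold.maximalAtlas (𝓡 n) ∞ N := IsManifold.chart_mem_maximalAtlas (φ p)
  have hpc : p ∈ c.source := mem_chart_source _ p
  have hpd : φ p ∈ d.source := mem_chart_source _ (φ p)
  have hfrequently : ∃ᶠ q in 𝓝 p, tensionInCharts g h φ c d =ᶠ[𝓝 (c q)] 0 := by
    refine ((mem_closure_iff_frequently.1 hp).and_eventually ((c.open_source.eventually_mem hpc).and
      ((d.open_source.preimage hφ.smooth.continuous).eventually_mem hpd))).mono ?_
    rintro q ⟨hq, hqc, hqd⟩
    exact (hφ.mem_interior_tensionZeroSet_iff hc hd hqc hqd).1 hq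
  exact (hφ.mem_interior_tensionZeroSet_iff hc hd hpc hpd).2 <|
    (hφ.isIsometricImmersionOn hc hd).eventuallyEq_tension_zero_of_mem_closure
      (fun x hx => hbi c hc d hd x hx.1 hx.2) (map_mem_chartDomain hpc hpd)
      (mem_closure_iff_frequently.2 ((c.continuousAt hpc).frequently hfrequently))

theorem isMinimal_of_tensionZeroSet_eq_univ (hφ : IsIsometricImmersion g h φ)
    (hzero : tensionZeroSet g h φ = Set.univ) : IsMinimal g h φ := by
  intro c hc d hd x hx hxd
  have hmem : c.symm x ∈ tensionZeroSet g h φ := hzero ▸ Set.mem_univ _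
  rw [hφ.mem_tensionZeroSet_iff hc hd (c.map_target hx) hxd, c.right_inv hx] at hmem
  exact ((hφ.isIsometricImmersionOn hc hd).meanCurvature_eq_zero_iff ⟨hx, hxd⟩).2 hmem

theorem fderiv_eq_zero [ConnectedSpace M] (hφ : IsIsometricImmersion g h φ)
    (humb : IsPseudoUmbilical g h φ) (hbi : IsBiharmonic g h φ) (hproper : ¬ IsMinimal g h φ)
    {f : M → ℝ} (hf : ContMDiff (𝓡 m) 𝓘(ℝ, ℝ) ∞ f)
    (hfbi : InAllCharts g h φ fun c G H φ' x => fBitension G H φ' (fun z => f (c.symm z)) x = 0)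
    (hc : c ∈ IsManifold.maximalAtlas (𝓡 m) ∞ M) {x : Coord m} (hx : x ∈ c.target) :
    fderiv ℝ (fun z => f (c.symm z)) x = 0 := by
  by_contra hne
  set d := chartAt (Coord n) (φ (c.symm x))
  have hd : d ∈ IsManifold.maximalAtlas (𝓡 n) ∞ N := IsManifold.chart_mem_maximalAtlas _
  have hxd : φ (c.symm x) ∈ d.source := mem_chart_source _ _
  have hφ' := hφ.isIsometricImmersionOn hc hd
  have hf' : ContDiffOn ℝ ∞ (fun z => f (c.symm z)) c.target :=
    contMDiffOn_iff_contDiffOn.1 (hf.comp_contMDiffOn (contMDiffOn_symm_of_mem_maximalAtlas hc))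
  have hcont : ContinuousAt (fderiv ℝ fun z => f (c.symm z)) x :=
    (hf'.contDiffAt (c.open_target.mem_nhds hx)).continuousAt_fderiv (by simp)
  have hτ : tensionInCharts g h φ c d =ᶠ[𝓝 x] 0 := by
    filter_upwards [hcont.eventually_ne hne, hφ'.source.isOpen.mem_nhds ⟨hx, hxd⟩] with y hy hyU
    by_contra hτy
    exact hy (hφ'.fderiv_eq_zero_of_tension_ne_zero hyU (humb c hc d hd y hyU.1 hyU.2)
      (hbi c hc d hd y hyU.1 hyU.2) (hfbi c hc d hd y hyU.1 hyU.2) hτy)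
  have hinterior : c.symm x ∈ interior (tensionZeroSet g h φ) :=
    (hφ.mem_interior_tensionZeroSet_iff hc hd (c.map_target hx) hxd).2 (by rwa [c.right_inv hx])
  have huniv := (hφ.isClopen_interior_tensionZeroSet hbi).eq_univ ⟨_, hinterior⟩
  exact hproper (hφ.isMinimal_of_tensionZeroSet_eq_univ (interior_eq_univ.1 huniv))

end IsIsometricImmersion

theorem exists_eq_const_of_fderiv_eq_zero [ConnectedSpace M] {f : M → ℝ}
    (hf : ContMDiff (𝓡 m) 𝓘(ℝ, ℝ) ∞ f)
    (hzero : ∀ c ∈ IsManifold.maximalAtlas (𝓡 m) ∞ M, ∀ x ∈ c.target,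
      fderiv ℝ (fun z => f (c.symm z)) x = 0) : ∃ C : ℝ, ∀ p : M, f p = C := by
  have hloc : IsLocallyConstant f := by
    refine (IsLocallyConstant.iff_eventually_eq f).2 fun p => ?_
    set c := chartAt (Coord m) p
    have hc : c ∈ IsManifold.maximalAtlas (𝓡 m) ∞ M := IsManifold.chart_mem_maximalAtlas p
    have hpc : p ∈ c.source := mem_chart_source _ p
    have hf' : ContDiffOn ℝ ∞ (fun z => f (c.symm z)) c.target :=
      contMDiffOn_iff_contDiffOn.1 (hf.comp_contMDiffOn (contMDiffOn_symm_of_mem_maximalAtlas hc))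
    obtain ⟨ε, hε, hball⟩ := Metric.isOpen_iff.1 c.open_target _ (c.map_source hpc)
    filter_upwards [c.open_source.mem_nhds hpc,
      (c.continuousAt hpc).preimage_mem_nhds (Metric.ball_mem_nhds _ hε)] with q hqc hq
    have hconst := Metric.isOpen_ball.is_const_of_fderiv_eq_zero (𝕜 := ℝ)
      (convex_ball (c p) ε).isPreconnected ((hf'.mono hball).differentiableOn (by simp))
      (fun x hx => hzero c hc x (hball hx)) hq (Metric.mem_ball_self hε)
    simpa only [c.left_inv hqc, c.left_inv hpc] using hconst
  obtain ⟨C, hC⟩ := hloc.exists_eq_const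
  exact ⟨C, congrFun hC⟩

end Manifolds

end FBiharm

end

theorem theorem2p4_general {m n : ℕ}
    {M : Type*} [TopologicalSpace M] [ChartedSpace (EuclideanSpace ℝ (Fin m)) M]
    [IsManifold (𝓡 m) ∞ M] [ConnectedSpace M]
    {N : Type*} [TopologicalSpace N] [ChartedSpace (EuclideanSpace ℝ (Fin n)) N]
    [IsManifold (𝓡 n) ∞ N]
    (g : FBiharm.RMetric m M) (h : FBiharm.RMetric n N) (φ : M → N)
    (hφ : FBiharm.IsIsometricImmersion g h φ)
    (humb : FBiharm.IsPseudoUmbilical g h φ)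
    (hbi : FBiharm.IsBiharmonic g h φ)
    (hproper : ¬ FBiharm.IsMinimal g h φ)
    (f : M → ℝ) (hf : ContMDiff (𝓡 m) 𝓘(ℝ, ℝ) ∞ f)
    (hfbi : FBiharm.InAllCharts g h φ fun c G H φ' x =>
      FBiharm.fBitension G H φ' (fun z => f (c.symm z)) x = 0) :
    ∃ C : ℝ, ∀ p : M, f p = C :=
  FBiharm.exists_eq_const_of_fderiv_eq_zero hf fun _ hc _ hx =>
    hφ.fderiv_eq_zero humb hbi hproper hf hfbi hc hx

theorem theorem2p4 {m n : ℕ}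
    {M : Type*} [TopologicalSpace M] [ChartedSpace (EuclideanSpace ℝ (Fin m)) M]
    [IsManifold (𝓡 m) ∞ M] [T2Space M] [SecondCountableTopology M] [ConnectedSpace M]
    {N : Type*} [TopologicalSpace N] [ChartedSpace (EuclideanSpace ℝ (Fin n)) N]
    [IsManifold (𝓡 n) ∞ N] [T2Space N] [SecondCountableTopology N]
    (g : FBiharm.RMetric m M) (h : FBiharm.RMetric n N) (φ : M → N)
    (hφ : FBiharm.IsIsometricImmersion g h φ)
    (humb : FBiharm.IsPseudoUmbilical g h φ)
    (hbi : FBiharm.IsBiharmonic g h φ)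
    (hproper : ¬ FBiharm.IsMinimal g h φ)
    (f : M → ℝ) (hf : FBiharm.IsFBiharmonic g h φ f) :
    ∃ C : ℝ, ∀ p : M, f p = C :=
  theorem2p4_general g h φ hφ humb hbi hproper f hf.smooth hf.equation
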